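/- Let $k$ be a finite field with $q$ elements and put $\mathbf v=\sqrt q$. Let $Q$ be the quiver $1\xrightarrow{\ \alpha\ }2$ with the trivial involution $\tau=\mathrm{Id}$. Its $\imath$quiver algebra is the finite-dimensional $k$-algebra $\Lambda^\imath=k\overline Q/\overline I$, where $\overline Q$ is obtained from $Q$ by adding a loop $\varepsilon_i$ at each vertex $i$ and $\overline I$ is generated by $\varepsilon_1^2$, $\varepsilon_2^2$ and $\varepsilon_2\alpha-\alpha\varepsilon_1$; modules are finite-dimensional left modules, i.e. representations of $\overline Q$ satisfying these relations. Let $\mathrm{res}:\mathrm{mod}(\Lambda^\imath)\to\mathrm{mod}(kQ)$ be restriction along $kQ\subset\Lambda^\imath$, and let $\langle X,Y\rangle_Q=\dim_k\mathrm{Hom}_{kQ}(X,Y)-\dim_k\mathrm{Ext}^1_{kQ}(X,Y)$ be the Euler form of $kQ$. The twisted Hall algebra of $\mathrm{mod}(\Lambda^\imath)$ is the $\mathbb Q(\mathbf v)$-algebra with basis the isomorphism classes $[M]$, unit $[0]$ and product $$[M]*[N]=\mathbf v^{\langle \mathrm{res}\,M,\mathrm{res}\,N\rangle_Q}\sum_{[L]}\frac{|\mathrm{Ext}^1(M,N)_L|}{|\mathrm{Hom}(M,N)|}\,[L],$$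 where $\mathrm{Ext}^1(M,N)_L$ is the set of classes of extensions $0\to N\to L'\to M\to0$ with $L'\cong L$. The $\imath$Hall algebra of $(Q,\tau)$ (the twisted semi-derived Ringel–Hall algebra of $\Lambda^\imath$) is obtained from it by dividing out the two-sided ideal generated by all $[M]-[N]$ such that $M$ and $N$ have the same class in $K_0(\mathrm{mod}(\Lambda^\imath))$ and are isomorphic in the singularity category of $\mathrm{mod}(\Lambda^\imath)$ (the Verdier quotient of $D^b(\mathrm{mod}(\Lambda^\imath))$ by the thick subcategory generated by the modules of finite projective dimension), and then inverting the classes $[K]$ of all modules $K$ of projective dimension at most $1$. For $i=1,2$ let $S_i$ be the simple module at the vertex $i$, and let $\mathbb E_i=k[\varepsilon_i]/(\varepsilon_i^2)$ be the generalized simple module supported at $i$. Then in the $\imath$Hall algebra $$[S_2]*[S_1]*[S_1]-(\mathbf v+\mathbf v^{-1})\,[S_1]*[S_2]*[S_1]+[S_1]*[S_1]*[S_2]=-\frac{(q-1)^2}{\mathbf v}\,[S_2]*[\mathbb E_1],$$ $$[S_1]*[S_2]*[S_2]-(\mathbf v+\mathbf v^{-1})\,[S_2]*[S_1]*[S_2]+[S_2]*[S_2]*[S_1]=-\frac{(q-1)^2}{\mathbf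 v}\,[S_1]*[\mathbb E_2].$$ -/

import Mathlib

universe v u

noncomputable section

namespace IHall

open CategoryTheory CategoryTheory.Limits

/-! ## Generalities on an abelian category: extensions, `K₀`, singularity category -/

section Abelian

variable {C : Type u} [Category.{v} C] [Abelian C]

/-- A short exact sequence `0 ⟶ N ⟶ L ⟶ M ⟶ 0` with prescribed objects. -/
structure Extension (M N L : C) where
  incl : N ⟶ L
  proj : L ⟶ M
  zero : incl ≫ proj = 0
  shortExact : (ShortComplex.mk incl proj zero).ShortExact

/-- Equivalence of extensions of `M` by `N`: an isomorphism of the middle terms which induces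
the identity on `N` and on `M`. -/
def extensionSetoid (M N L : C) : Setoid (Extension M N L) where
  r E E' := ∃ φ : L ≅ L, E.incl ≫ φ.hom = E'.incl ∧ φ.hom ≫ E'.proj = E.proj
  iseqv :=
    { refl := fun E => ⟨Iso.refl L, by simp, by simp⟩
      symm := by
        rintro E E' ⟨φ, h₁, h₂⟩
        exact ⟨φ.symm, by simp [← h₁], by simp [← h₂]⟩
      trans := by
        rintro E E' E'' ⟨φ, h₁, h₂⟩ ⟨ψ, h₃, h₄⟩
        exact ⟨φ ≪≫ ψ, by simp [← h₃, ← h₁], by simp [h₄, h₂]⟩ }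

/-- `Ext¹(M, N)_L`: the Yoneda classes of extensions `0 ⟶ N ⟶ L ⟶ M ⟶ 0` whose middle term
is (isomorphic to) `L`. -/
def ExtMiddle (M N L : C) : Type v := Quotient (extensionSetoid M N L)

/-- The structure constant `|Ext¹(M, N)_L| / |Hom(M, N)|` of the Hall algebra. -/
def hallCoeff (M N L : C) : ℚ := (Nat.card (ExtMiddle M N L) : ℚ) / (Nat.card (M ⟶ N) : ℚ)

variable (C) in
/-- The set `Iso(C)` of isomorphism classes of objects. -/
def IsoClass : Type u := Quotient (isIsomorphicSetoid C)

/-- The isomorphism class of an object. -/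
def isoClass (M : C) : IsoClass C := Quotient.mk (isIsomorphicSetoid C) M

/-- A representative of an isomorphism class. -/
def IsoClass.rep (c : IsoClass C) : C := Quotient.out c

variable (C) in
/-- The relations `[L] - [M] - [N]`, one for every short exact sequence `0 ⟶ N ⟶ L ⟶ M ⟶ 0`. -/
def k0Relations : AddSubgroup (FreeAbelianGroup (IsoClass C)) :=
  AddSubgroup.closure {x | ∃ M N L : C, Nonempty (Extension M N L) ∧
    x = FreeAbelianGroup.of (isoClass L) - FreeAbelianGroup.of (isoClass M)
      - FreeAbelianGroup.of (isoClass N)}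

variable (C) in
/-- The Grothendieck group `K₀(C)`. -/
abbrev K0 : Type u := FreeAbelianGroup (IsoClass C) ⧸ k0Relations C

/-- The class of an object in `K₀(C)`. -/
def k0Class (M : C) : K0 C :=
  QuotientAddGroup.mk (s := k0Relations C) (FreeAbelianGroup.of (isoClass M))

section Singularity

variable [HasDerivedCategory.{max u v} C]

/-- The object of `D^b(C)` given by an object of `C` placed in degree `0`. -/
def toBounded (M : C) : DerivedCategory.Bounded C :=
  ⟨(DerivedCategory.singleFunctor C 0).obj M,
    ⟨0, inferInstanceAs (((DerivedCategory.singleFunctor C 0).obj M).IsGE 0)⟩,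
    ⟨0, inferInstanceAs (((DerivedCategory.singleFunctor C 0).obj M).IsLE 0)⟩⟩

variable (C) in
/-- The thick (triangulated, closed under direct summands) subcategory of `D^b(C)` generated by
the objects of `C` of finite projective dimension. -/
def perfect : ObjectProperty (DerivedCategory.Bounded C) := fun X =>
  ∀ T : ObjectProperty (DerivedCategory.Bounded C),
    T.IsTriangulated → T.IsStableUnderRetracts →
    (∀ (M : C) (n : ℕ), HasProjectiveDimensionLE M n → T (toBounded M)) → T X

variable (C) in
/-- The singularity category `D_sg(C)`: the Verdier quotient of `D^b(C)` by `perfect C`. -/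
abbrev SingularityCategory := (perfect C).trW.Localization

/-- The image in `D_sg(C)` of an object of `C`. -/
def toSingularity (M : C) : SingularityCategory C := (perfect C).trW.Q.obj (toBounded M)

end Singularity

/-- `M ≅ N` in the singularity category `D_sg(C)`. -/
def SingularIso (M N : C) : Prop :=
  letI : HasDerivedCategory.{max u v} C := HasDerivedCategory.standard C
  Nonempty (toSingularity M ≅ toSingularity N)

end Abelian

/-! ## The algebras attached to the ıquiver `1 ⟶ 2` with trivial involution -/

/-- The vertices of the quiver `1 ⟶ 2`. -/
inductive Vertex
  | one
  | two
  deriving DecidableEq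

/-- Vertices and arrows of the quiver `Q : 1 ⟶ 2`. -/
inductive QGen
  | e (i : Vertex)
  | α

/-- Vertices and arrows of the quiver obtained from `Q : 1 ⟶ 2` by adding a loop `ε i` at each
vertex `i`. -/
inductive IGen
  | e (i : Vertex)
  | α
  | ε (i : Vertex)

section Algebras

variable (k : Type u) [Field k]

/-- The relations of the path algebra `kQ`. Paths are composed like maps, so that left modules are
representations of `Q`. -/
inductive QRel : FreeAlgebra k QGen → FreeAlgebra k QGen → Prop
  | sum : QRel (.ι k (.e .one) + .ι k (.e .two)) 1
  | idem (i : Vertex) : QRel (.ι k (.e i) * .ι k (.e i)) (.ι k (.e i))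
  | orth (i j : Vertex) (h : i ≠ j) : QRel (.ι k (.e i) * .ι k (.e j)) 0
  | source : QRel (.ι k .α * .ι k (.e .one)) (.ι k .α)
  | target : QRel (.ι k (.e .two) * .ι k .α) (.ι k .α)

/-- The path algebra `kQ` of `Q : 1 ⟶ 2`. -/
abbrev PathAlg : Type u := RingQuot (QRel k)

/-- The relations of the ıquiver algebra `Λ^ı` of `Q : 1 ⟶ 2` with trivial involution: those of the
path algebra of `Q` with loops `ε i`, the relations `(ε i)² = 0`, and `ε₂ α = α ε₁`. -/
inductive IRel : FreeAlgebra k IGen → FreeAlgebra k IGen → Prop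
  | sum : IRel (.ι k (.e .one) + .ι k (.e .two)) 1
  | idem (i : Vertex) : IRel (.ι k (.e i) * .ι k (.e i)) (.ι k (.e i))
  | orth (i j : Vertex) (h : i ≠ j) : IRel (.ι k (.e i) * .ι k (.e j)) 0
  | source : IRel (.ι k .α * .ι k (.e .one)) (.ι k .α)
  | target : IRel (.ι k (.e .two) * .ι k .α) (.ι k .α)
  | loop_source (i : Vertex) : IRel (.ι k (.ε i) * .ι k (.e i)) (.ι k (.ε i))
  | loop_target (i : Vertex) : IRel (.ι k (.e i) * .ι k (.ε i)) (.ι k (.ε i))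
  | nilp (i : Vertex) : IRel (.ι k (.ε i) * .ι k (.ε i)) 0
  | comm : IRel (.ι k (.ε .two) * .ι k .α) (.ι k .α * .ι k (.ε .one))

/-- The ıquiver algebra `Λ^ı`. -/
abbrev ILambda : Type u := RingQuot (IRel k)

/-- The image in `Λ^ı` of a vertex or an arrow. -/
def ILambda.gen (x : IGen) : ILambda k := RingQuot.mkAlgHom k (IRel k) (FreeAlgebra.ι k x)

/-- The inclusion `kQ ⟶ Λ^ı`. -/
def inclQ : PathAlg k →ₐ[k] ILambda k :=
  RingQuot.liftAlgHom k ⟨FreeAlgebra.lift k fun x : QGen => match x with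
    | .e i => ILambda.gen k (.e i)
    | .α => ILambda.gen k .α, by
      intro x y h
      cases h with
      | sum => simpa [ILambda.gen] using RingQuot.mkAlgHom_rel k (IRel.sum (k := k))
      | idem i => simpa [ILambda.gen] using RingQuot.mkAlgHom_rel k (IRel.idem (k := k) i)
      | orth i j h => simpa [ILambda.gen] using RingQuot.mkAlgHom_rel k (IRel.orth (k := k) i j h)
      | source => simpa [ILambda.gen] using RingQuot.mkAlgHom_rel k (IRel.source (k := k))
      | target => simpa [ILambda.gen] using RingQuot.mkAlgHom_rel k (IRel.target (k := k))⟩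

section Table

variable {k}

open ILambda in
lemma gen_rels :
    (gen k (.e .one) + gen k (.e .two) = 1) ∧
    (∀ i, gen k (.e i) * gen k (.e i) = gen k (.e i)) ∧
    (∀ i j, i ≠ j → gen k (.e i) * gen k (.e j) = 0) ∧
    (gen k .α * gen k (.e .one) = gen k .α) ∧
    (gen k (.e .two) * gen k .α = gen k .α) ∧
    (∀ i, gen k (.ε i) * gen k (.e i) = gen k (.ε i)) ∧
    (∀ i, gen k (.e i) * gen k (.ε i) = gen k (.ε i)) ∧
    (∀ i, gen k (.ε i) * gen k (.ε i) = 0) ∧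
    (gen k (.ε .two) * gen k .α = gen k .α * gen k (.ε .one)) := by
  refine ⟨?_, fun i => ?_, fun i j h => ?_, ?_, ?_, fun i => ?_, fun i => ?_, fun i => ?_, ?_⟩
  · simpa [gen] using RingQuot.mkAlgHom_rel k (IRel.sum (k := k))
  · simpa [gen] using RingQuot.mkAlgHom_rel k (IRel.idem (k := k) i)
  · simpa [gen] using RingQuot.mkAlgHom_rel k (IRel.orth (k := k) i j h)
  · simpa [gen] using RingQuot.mkAlgHom_rel k (IRel.source (k := k))
  · simpa [gen] using RingQuot.mkAlgHom_rel k (IRel.target (k := k))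
  · simpa [gen] using RingQuot.mkAlgHom_rel k (IRel.loop_source (k := k) i)
  · simpa [gen] using RingQuot.mkAlgHom_rel k (IRel.loop_target (k := k) i)
  · simpa [gen] using RingQuot.mkAlgHom_rel k (IRel.nilp (k := k) i)
  · simpa [gen] using RingQuot.mkAlgHom_rel k (IRel.comm (k := k))

open ILambda in
/-- The span of `e₁, e₂, α, ε₁, ε₂, α ε₁` in `Λ^ı`. -/
def spanBasis : Submodule k (ILambda k) :=
  Submodule.span k {gen k (.e .one), gen k (.e .two), gen k .α, gen k (.ε .one), gen k (.ε .two),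
    gen k .α * gen k (.ε .one)}

open ILambda in
lemma gen_mul_mem (x : IGen) (y : ILambda k) (hy : y ∈ spanBasis (k := k)) :
    gen k x * y ∈ spanBasis (k := k) := by
  obtain ⟨-, idem, orth, src, tgt, lsrc, ltgt, nil, com⟩ := gen_rels (k := k)
  have o12 := orth .one .two (by simp)
  have o21 := orth .two .one (by simp)
  have a1 : gen k (.e .one) * gen k .α = 0 := by rw [← tgt, ← mul_assoc, o12, zero_mul]
  have a2 : gen k .α * gen k (.e .two) = 0 := by rw [← src, mul_assoc, o12, mul_zero]
  have aa : gen k .α * gen k .α = 0 := by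
    nth_rewrite 2 [← tgt]; rw [← mul_assoc, a2, zero_mul]
  have b1 : gen k (.e .one) * gen k (.ε .two) = 0 := by
    rw [← ltgt .two, ← mul_assoc, o12, zero_mul]
  have b2 : gen k (.e .two) * gen k (.ε .one) = 0 := by
    rw [← ltgt .one, ← mul_assoc, o21, zero_mul]
  have c1 : gen k (.ε .one) * gen k (.e .two) = 0 := by
    rw [← lsrc .one, mul_assoc, o12, mul_zero]
  have c2 : gen k (.ε .two) * gen k (.e .one) = 0 := by
    rw [← lsrc .two, mul_assoc, o21, mul_zero]
  have d1 : gen k (.ε .one) * gen k .α = 0 := by rw [← tgt, ← mul_assoc, c1, zero_mul]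
  have d2 : gen k .α * gen k (.ε .two) = 0 := by
    rw [← ltgt .two, ← mul_assoc, a2, zero_mul]
  have e1 : gen k (.ε .one) * gen k (.ε .two) = 0 := by
    rw [← ltgt .two, ← mul_assoc, c1, zero_mul]
  have e2 : gen k (.ε .two) * gen k (.ε .one) = 0 := by
    rw [← ltgt .one, ← mul_assoc, c2, zero_mul]
  have hS : ∀ z ∈ ({gen k (.e .one), gen k (.e .two), gen k .α, gen k (.ε .one),
      gen k (.ε .two), gen k .α * gen k (.ε .one)} : Set (ILambda k)), z ∈ spanBasis (k := k) :=
    fun z hz => Submodule.subset_span hz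
  induction hy using Submodule.span_induction with
  | mem z hz =>
    simp only [Set.mem_insert_iff, Set.mem_singleton_iff] at hz
    have h0 : (0 : ILambda k) ∈ spanBasis (k := k) := zero_mem _
    rcases x with i | _ | i
    all_goals try cases i
    all_goals
      rcases hz with rfl | rfl | rfl | rfl | rfl | rfl <;>
      (try simp only [idem, o12, o21, a1, a2, b1, b2, c1, c2, d1, d2, e1, e2, src, tgt, lsrc, ltgt, nil,
        com, aa, ← mul_assoc, zero_mul]) <;>
      first
        | exact h0
        | (apply hS; simp; done)
        | (rw [mul_assoc, nil, mul_zero]; exact h0)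
  | zero => simp
  | add a b _ _ ha hb => rw [mul_add]; exact add_mem ha hb
  | smul c a _ ha => rw [mul_smul_comm]; exact Submodule.smul_mem _ c ha

end Table

/-- `Λ^ı` is finite-dimensional (spanned by `e₁, e₂, α, ε₁, ε₂, α ε₁`). -/
instance finite_ILambda : Module.Finite k (ILambda k) := by
  have key : ∀ (x : FreeAlgebra k IGen) (y : ILambda k), y ∈ spanBasis (k := k) →
      RingQuot.mkAlgHom k (IRel k) x * y ∈ spanBasis (k := k) := by
    intro x
    induction x using FreeAlgebra.induction with
    | grade0 r =>
      intro y hy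
      rw [AlgHom.commutes, ← Algebra.smul_def]
      exact Submodule.smul_mem _ r hy
    | grade1 x => exact gen_mul_mem x
    | mul a b ha hb =>
      intro y hy
      rw [map_mul, mul_assoc]
      exact ha _ (hb _ hy)
    | add a b ha hb =>
      intro y hy
      rw [map_add, add_mul]
      exact add_mem (ha _ hy) (hb _ hy)
  have one_mem : (1 : ILambda k) ∈ spanBasis (k := k) := by
    rw [← (gen_rels (k := k)).1]
    exact add_mem (Submodule.subset_span (by simp)) (Submodule.subset_span (by simp))
  have top : spanBasis (k := k) = ⊤ := by
    rw [eq_top_iff]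
    intro z _
    obtain ⟨x, rfl⟩ := RingQuot.mkAlgHom_surjective k (IRel k) z
    simpa using key x 1 one_mem
  exact ⟨top ▸ Submodule.fg_span (Set.toFinite _)⟩

instance isNoetherianRing_ILambda : IsNoetherianRing (ILambda k) :=
  isNoetherian_of_tower k inferInstance

/-- The category `mod(Λ^ı)` of finite-dimensional (left) `Λ^ı`-modules. -/
abbrev ModI := FGModuleCat.{u} (ILambda k)

/-- The algebra map `Λ^ı ⟶ k` sending `e i` to `1` and all other vertices and arrows to `0`. -/
def simpleHom (i : Vertex) : ILambda k →ₐ[k] k :=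
  RingQuot.liftAlgHom k ⟨FreeAlgebra.lift k fun x : IGen => match x with
    | .e j => if j = i then 1 else 0
    | .α => 0
    | .ε _ => 0, by
      intro x y h
      cases h <;> cases i <;> simp <;> grind⟩

/-- The algebra map `Λ^ı ⟶ k[ε]/(ε²)` sending `e i` to `1`, `ε i` to `ε`, and all other vertices
and arrows to `0`. -/
def genSimpleHom (i : Vertex) : ILambda k →ₐ[k] DualNumber k :=
  RingQuot.liftAlgHom k ⟨FreeAlgebra.lift k fun x : IGen => match x with
    | .e j => if j = i then 1 else 0
    | .α => 0
    | .ε j => if j = i then DualNumber.eps else 0, by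
      intro x y h
      cases h <;> cases i <;> simp <;> grind⟩

variable {k} in
/-- A finite-dimensional `k`-algebra `B`, viewed as a `Λ^ı`-module through an algebra map
`Λ^ı ⟶ B`. -/
def pullback {B : Type u} [Ring B] [Algebra k B] [Module.Finite k B]
    (φ : ILambda k →ₐ[k] B) : ModI k :=
  ⟨(ModuleCat.restrictScalars φ.toRingHom).obj (ModuleCat.of B B), by
    let _ : Module (ILambda k) B := Module.compHom B φ.toRingHom
    have : IsScalarTower k (ILambda k) B := ⟨fun a x b => by
      change φ (a • x) * b = a • (φ x * b)
      rw [map_smul, smul_mul_assoc]⟩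
    exact (Module.Finite.of_restrictScalars_finite k (ILambda k) B :)⟩

/-- The simple module `S_i`. -/
def simpleModule (i : Vertex) : ModI k := pullback (simpleHom k i)

instance finite_dualNumber : Module.Finite k (DualNumber k) :=
  inferInstanceAs (Module.Finite k (k × k))

/-- The generalized simple module `𝔼_i = k[ε_i]/(ε_i²)`. -/
def genSimpleModule (i : Vertex) : ModI k := pullback (genSimpleHom k i)

variable {k} in
/-- The restriction functor `mod(Λ^ı) ⟶ mod(kQ)` on objects. -/
def res (M : ModI k) : ModuleCat.{u} (PathAlg k) :=
  (ModuleCat.restrictScalars (inclQ k).toRingHom).obj M.obj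

variable {k} in
/-- The Euler form `⟨M, N⟩_Q = dim Hom(M, N) - dim Ext¹(M, N)` of the path algebra `kQ`. -/
def eulerForm (M N : ModuleCat.{u} (PathAlg k)) : ℤ :=
  (Module.finrank k (M ⟶ N) : ℤ) - (Module.finrank k (Abelian.Ext.{u} M N 1) : ℤ)

/-! ## The ıHall algebra -/

/-- The number `√q`, where `q` is the number of elements of `k`. -/
def sqrtQ : ℝ := Real.sqrt (Nat.card k)

/-- The coefficient field `ℚ(√q)`. -/
abbrev Coeff : Type := IntermediateField.adjoin ℚ {sqrtQ k}

/-- The element `√q` of `ℚ(√q)`. -/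
def vv : Coeff k := IntermediateField.AdjoinSimple.gen ℚ (sqrtQ k)

/-- The `Λ^ı`-modules of projective dimension at most one. -/
abbrev PdLEOne : Type (u + 1) := {K : ModI k // HasProjectiveDimensionLE K 1}

/-- Generators of the ıHall algebra: the classes `[M]`, and inverses of the classes `[K]` for `K`
of projective dimension at most one. -/
inductive HGen : Type (u + 1)
  | cls (c : IsoClass (ModI k))
  | inv (K : PdLEOne k)

variable {k} in
/-- The generator `[M]` in the free algebra. -/
def freeClass (M : ModI k) : FreeAlgebra (Coeff k) (HGen k) := .ι (Coeff k) (.cls (isoClass M))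

/-- The relations of the ıHall algebra:
* `zero`, `mul`: the twisted Hall algebra of `mod(Λ^ı)`, with unit `[0]` and product
  `[M] * [N] = √q ^ ⟨res M, res N⟩_Q ∑_[L] |Ext¹(M, N)_L| / |Hom(M, N)| [L]`
  (a finite sum);
* `ideal`: the quotient by the two-sided ideal generated by all `[M] - [N]` for `M`, `N` with the
  same class in `K₀` and isomorphic in the singularity category;
* `inv_mul`, `mul_inv`: the localization at the classes of modules of projective dimension at most
  one. -/
inductive HRel : FreeAlgebra (Coeff k) (HGen k) → FreeAlgebra (Coeff k) (HGen k) → Prop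
  | zero (Z : ModI k) (h : IsZero Z) : HRel (freeClass Z) 1
  | mul (M N : ModI k) : HRel (freeClass M * freeClass N)
      (vv k ^ eulerForm (res M) (res N) •
        ∑ᶠ c : IsoClass (ModI k), (hallCoeff M N c.rep : Coeff k) • .ι (Coeff k) (.cls c))
  | ideal (M N : ModI k) (h₀ : k0Class M = k0Class N) (h : SingularIso M N) :
      HRel (freeClass M) (freeClass N)
  | inv_mul (K : PdLEOne k) : HRel (.ι (Coeff k) (.inv K) * freeClass K.1) 1
  | mul_inv (K : PdLEOne k) : HRel (freeClass K.1 * .ι (Coeff k) (.inv K)) 1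

/-- The ıHall algebra of `1 ⟶ 2` with trivial involution, i.e. the twisted semi-derived
Ringel-Hall algebra of `Λ^ı`: the universal `ℚ(√q)`-algebra obtained from the twisted Hall algebra
of `mod(Λ^ı)` by passing to the quotient by the ideal above and inverting the classes of modules of
projective dimension at most one. -/
abbrev IHallAlgebra : Type (u + 1) := RingQuot (HRel k)

variable {k} in
/-- The class `[M]` in the ıHall algebra. -/
def cls (M : ModI k) : IHallAlgebra k := RingQuot.mkAlgHom (Coeff k) (HRel k) (freeClass M)

end Algebras

end IHall

end

/-! Every product in the two relations is a product of modules of total dimension at most three, so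
it can be computed by hand. Let X = S₁ ⊕ S₂, let U be the indecomposable module with arrow 1 and
zero loops, and let T_ab be the module of dimension vector (2, 1) with loop a·(Jordan block) at
vertex 1 and arrow b·(second projection). Counting extensions and morphisms gives, with q = v², S₂S₁
= X, S₁S₂ = v⁻¹(X + (q-1)U), S₁U = T₀₁, S₂𝔼₁ = T₁₀, XS₁ = v⁻¹(T₀₀ + (q-1)T₁₀), S₁X = q⁻¹(T₀₀ +
(q-1)T₁₀ + (q-1)T₀₁ + (q-1)²T₁₁). Substituting, the left-hand side of the first relation collapses
to -v⁻¹(q-1)²T₁₁. In the ordinary Hall algebra T₁₁ and T₁₀ differ, but both are extensions of 𝔼₁ by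
S₂. Since 𝔼₁ has projective dimension at most 1, through 0 → 𝔼₂ → Λe₁ → 𝔼₁ → 0, both become
isomorphic to S₂ in the singularity category, and they have the same class in K₀. Hence T₁₁ = T₁₀ =
S₂𝔼₁ in the ıHall algebra (`cls_dim21_one`). The second relation is dual, with modules of dimension
vector (1, 2) and with 𝔼₂ projective (`cls_dim12_one`).

Three tools carry the computation. Modules are replaced by representations (`IRep`), and extensions
by block-triangular matrices, i.e. cocycles modulo coboundaries; this turns a Hall product into a
sum over representatives of cocycles (`cls_mul_cls_of_cocycles`). The Euler form is read off from
dimension vectors by the standard projective resolution over kQ (`eulerForm_res`). The resulting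
linear algebra is isolated in `serre_relation_one` and `serre_relation_two`, valid in any algebra.
-/

noncomputable section

namespace IHall

open CategoryTheory CategoryTheory.Limits

/-! ### Extensions in an abelian category: singularity category, K₀, counting. -/

section Category

variable {C : Type u} [Category.{v} C]

lemma isoClass_eq_iff {M N : C} : isoClass M = isoClass N ↔ Nonempty (M ≅ N) :=
  Quotient.eq

lemma isoClass_rep (c : IsoClass C) : isoClass c.rep = c := Quotient.out_eq c

lemma comp_inv_app_comp_hom_app {D : Type*} [Category* D] {F G : C ⥤ D} (α : F ≅ G) (X : C) {Y : D}
    (d : Y ⟶ G.obj X) : (d ≫ α.inv.app X) ≫ α.hom.app X = d := by simp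

end Category

section Abelian

variable {C : Type u} [Category.{v} C] [Abelian C]

section Singularity

variable [HasDerivedCategory.{max u v} C]

open Pretriangulated

/-- The triangle in `D^b(C)` attached to an extension. -/
lemma exists_bounded_triangle {M N L : C} (E : Extension M N L) :
    ∃ (f : toBounded N ⟶ toBounded L) (g : toBounded L ⟶ toBounded M)
      (h : toBounded M ⟶ (toBounded N)⟦(1 : ℤ)⟧),
      Triangle.mk f g h ∈ distTriang (DerivedCategory.Bounded C) := by
  let ι := DerivedCategory.Bounded.ι (C := C)
  let f : toBounded N ⟶ toBounded L :=
    ObjectProperty.homMk ((DerivedCategory.singleFunctor C 0).map E.incl)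
  let g : toBounded L ⟶ toBounded M :=
    ObjectProperty.homMk ((DerivedCategory.singleFunctor C 0).map E.proj)
  -- The connecting morphism lives in the full derived category; it descends because D^b is a full
  -- subcategory compatible with the shift.
  let h : toBounded M ⟶ (toBounded N)⟦(1 : ℤ)⟧ :=
    ι.preimage (E.shortExact.singleδ ≫ (ι.commShiftIso (1 : ℤ)).inv.app (toBounded N))
  refine ⟨f, g, h, ?_⟩
  rw [← ι.map_distinguished_iff]
  refine isomorphic_distinguished _ E.shortExact.singleTriangle_distinguished _ ?_
  refine Triangle.isoMk _ _ (Iso.refl _) (Iso.refl _) (Iso.refl _) ?_ ?_ ?_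
  · exact (Category.comp_id _).trans (Category.id_comp _).symm
  · exact (Category.comp_id _).trans (Category.id_comp _).symm
  · have : ι.map h = E.shortExact.singleδ ≫ (ι.commShiftIso (1 : ℤ)).inv.app (toBounded N) :=
      ι.map_preimage _
    have h' : ι.map h ≫ (ι.commShiftIso (1 : ℤ)).hom.app (toBounded N) = E.shortExact.singleδ := by
      rw [this]
      exact comp_inv_app_comp_hom_app (ι.commShiftIso (1 : ℤ)) (toBounded N) E.shortExact.singleδ
    exact (whisker_eq _ (CategoryTheory.Functor.map_id _ _)).trans
      ((Category.comp_id _).trans (h'.trans (Category.id_comp _).symm))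

lemma perfect_of_hasProjectiveDimensionLE (M : C) (n : ℕ) (h : HasProjectiveDimensionLE M n) :
    perfect C (toBounded M) := fun _ _ _ hT => hT M n h

lemma perfect_shift (X : DerivedCategory.Bounded C) (h : perfect C X) (n : ℤ) :
    perfect C (X⟦n⟧) := fun T h₁ h₂ h₃ => T.le_shift n _ (h T h₁ h₂ h₃)

/-- The cone of N ⟶ L is M, which is perfect, so the Verdier quotient inverts N ⟶ L. -/
lemma toSingularity_iso_of_extension {M N L : C} (E : Extension M N L) (n : ℕ)
    (h : HasProjectiveDimensionLE M n) : Nonempty (toSingularity N ≅ toSingularity L) := by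
  obtain ⟨f, g, δ, hT⟩ := exists_bounded_triangle E
  have hf : (perfect C).trW f :=
    ObjectProperty.trW.mk _ hT (perfect_of_hasProjectiveDimensionLE M n h)
  exact ⟨@asIso _ _ _ _ _ ((perfect C).trW.Q_inverts f hf)⟩

/-- After rotation, the cone of L ⟶ M is N[1], again perfect. -/
lemma toSingularity_iso_of_extension' {M N L : C} (E : Extension M N L) (n : ℕ)
    (h : HasProjectiveDimensionLE N n) : Nonempty (toSingularity L ≅ toSingularity M) := by
  obtain ⟨f, g, δ, hT⟩ := exists_bounded_triangle E
  have hg : (perfect C).trW g :=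
    ObjectProperty.trW.mk _ (rot_of_distTriang _ hT)
      (perfect_shift _ (perfect_of_hasProjectiveDimensionLE N n h) 1)
  exact ⟨@asIso _ _ _ _ _ ((perfect C).trW.Q_inverts g hg)⟩

end Singularity

/-- Two extensions of `M` by `N` have singularly isomorphic middle terms if `M` has finite
projective dimension. -/
lemma singularIso_of_extensions {M N L L' : C} (E : Extension M N L) (E' : Extension M N L')
    (n : ℕ) (h : HasProjectiveDimensionLE M n) : SingularIso L L' := by
  let _ : HasDerivedCategory.{max u v} C := HasDerivedCategory.standard C
  obtain ⟨e⟩ := toSingularity_iso_of_extension E n h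
  obtain ⟨e'⟩ := toSingularity_iso_of_extension E' n h
  exact ⟨e.symm ≪≫ e'⟩

/-- Two extensions of `M` by `N` have singularly isomorphic middle terms if `N` has finite
projective dimension. -/
lemma singularIso_of_extensions' {M N L L' : C} (E : Extension M N L) (E' : Extension M N L')
    (n : ℕ) (h : HasProjectiveDimensionLE N n) : SingularIso L L' := by
  let _ : HasDerivedCategory.{max u v} C := HasDerivedCategory.standard C
  obtain ⟨e⟩ := toSingularity_iso_of_extension' E n h
  obtain ⟨e'⟩ := toSingularity_iso_of_extension' E' n h
  exact ⟨e ≪≫ e'.symm⟩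

lemma k0Class_extension {M N L : C} (E : Extension M N L) :
    k0Class L = k0Class M + k0Class N := by
  rw [← sub_eq_zero, ← sub_sub]
  exact (QuotientAddGroup.eq_zero_iff _).2 (AddSubgroup.subset_closure ⟨M, N, L, ⟨E⟩, rfl⟩)

/-- Transport of an extension along an isomorphism of the middle term. -/
def Extension.congr {M N L L' : C} (E : Extension M N L) (e : L ≅ L') : Extension M N L' where
  incl := E.incl ≫ e.hom
  proj := e.inv ≫ E.proj
  zero := by simp [E.zero]
  shortExact := ShortComplex.shortExact_of_iso
    (S₁ := .mk E.incl E.proj E.zero)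
    (ShortComplex.isoMk (Iso.refl _) e (Iso.refl _) (by simp) (by simp)) E.shortExact

/-- Equivalence of extensions with possibly different middle terms. -/
def Extension.Equivalent {M N L L' : C} (E : Extension M N L) (E' : Extension M N L') : Prop :=
  ∃ φ : L ≅ L', E.incl ≫ φ.hom = E'.incl ∧ φ.hom ≫ E'.proj = E.proj

/-- A family of extensions of `M` by `N` representing each equivalence class exactly once
computes all sets `Ext¹(M, N)_L`. -/
lemma card_extMiddle {M N : C} {Θ : Type*} (L : Θ → C) (E : ∀ θ, Extension M N (L θ))
    (complete : ∀ (L' : C) (E' : Extension M N L'), ∃ θ, (E θ).Equivalent E')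
    (irredundant : ∀ θ θ', (E θ).Equivalent (E θ') → θ = θ') (L' : C) :
    Nat.card (ExtMiddle M N L') = Nat.card {θ // isoClass (L θ) = isoClass L'} := by
  symm
  -- The choice of isomorphism L θ ≅ L' does not matter: two choices differ by an automorphism of
  -- L', which is an equivalence between the transported extensions.
  let F : {θ // isoClass (L θ) = isoClass L'} → ExtMiddle M N L' := fun θ =>
    Quotient.mk (extensionSetoid M N L') ((E θ.1).congr (isoClass_eq_iff.1 θ.2).some)
  refine Nat.card_congr (Equiv.ofBijective F ⟨?_, ?_⟩)
  · rintro ⟨θ, h⟩ ⟨θ', h'⟩ hF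
    obtain ⟨φ, h₁, h₂⟩ := Quotient.exact hF
    refine Subtype.ext (irredundant θ θ'
      ⟨(isoClass_eq_iff.1 h).some ≪≫ φ ≪≫ (isoClass_eq_iff.1 h').some.symm, ?_, ?_⟩)
    · simp only [Extension.congr] at h₁
      simp only [Category.assoc] at h₁
      simp [reassoc_of% h₁]
    · simp only [Extension.congr] at h₂
      simp [h₂]
  · intro x
    obtain ⟨E', rfl⟩ := Quotient.exists_rep x
    obtain ⟨θ, φ, h₁, h₂⟩ := complete L' E'
    have h : isoClass (L θ) = isoClass L' := isoClass_eq_iff.2 ⟨φ⟩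
    refine ⟨⟨θ, h⟩, Quotient.sound ⟨(isoClass_eq_iff.1 h).some.symm ≪≫ φ, ?_, ?_⟩⟩
    · simp [Extension.congr, h₁]
    · simp [Extension.congr, h₂]

end Abelian

/-! ### Products in the ıHall algebra as sums over extension classes. -/

section Algebra

variable {k : Type u} [Field k]

lemma cls_congr {M N : ModI k} (h : isoClass M = isoClass N) : cls M = cls N := by
  rw [cls, cls, freeClass, freeClass, h]

/-- Middle terms of extensions with the same ends have the same class in K₀, so only the condition
in the singularity category remains. -/
lemma cls_eq_of_extensions {M N L L' : ModI k} (E : Extension M N L) (E' : Extension M N L')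
    (h : SingularIso L L') : cls L = cls L' :=
  RingQuot.mkAlgHom_rel (Coeff k)
    (HRel.ideal L L' (by rw [k0Class_extension E, k0Class_extension E']) h)

lemma algHom_map_smul {R A B : Type*} [CommSemiring R] [Semiring A] [Semiring B] [Algebra R A]
    [Algebra R B] (f : A →ₐ[R] B) (r : R) (x : A) : f (r • x) = r • f x := map_smul f r x

/-- The coefficient of [L] counts the θ with middle term isomorphic to L, so the sum over
isomorphism classes is a sum over θ grouped by fibres of θ ↦ [L θ]. This form never requires
deciding which middle terms are isomorphic. -/
lemma cls_mul_cls {M N : ModI k} {Θ : Type*} [Fintype Θ] (L : Θ → ModI k)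
    (E : ∀ θ, Extension M N (L θ))
    (complete : ∀ (L' : ModI k) (E' : Extension M N L'), ∃ θ, (E θ).Equivalent E')
    (irredundant : ∀ θ θ', (E θ).Equivalent (E θ') → θ = θ') :
    cls M * cls N = (vv k ^ eulerForm (res M) (res N) / (Nat.card (M ⟶ N) : Coeff k)) •
      ∑ θ, cls (L θ) := by
  classical
  have key : (∑ᶠ c : IsoClass (ModI k), (hallCoeff M N c.rep : Coeff k) •
      (FreeAlgebra.ι (Coeff k) (HGen.cls c) : FreeAlgebra (Coeff k) (HGen k))) =
      (Nat.card (M ⟶ N) : Coeff k)⁻¹ • ∑ θ, freeClass (L θ) := by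
    have h1 : ∀ c : IsoClass (ModI k), (hallCoeff M N c.rep : Coeff k) =
        (Nat.card (M ⟶ N) : Coeff k)⁻¹ *
          ((Finset.univ.filter fun θ => isoClass (L θ) = c).card : Coeff k) := by
      intro c
      rw [hallCoeff, card_extMiddle L E complete irredundant, isoClass_rep,
        Nat.card_eq_fintype_card,
        Fintype.card_subtype]
      push_cast
      rw [div_eq_inv_mul]
    -- Only the finitely many classes of the L θ have a nonzero coefficient.
    rw [finsum_eq_sum_of_support_subset (s := Finset.univ.image fun θ => isoClass (L θ))]
    · simp_rw [h1, mul_smul]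
      rw [← Finset.smul_sum]
      congr 1
      rw [← Finset.sum_fiberwise_of_maps_to
        (g := fun θ => isoClass (L θ)) (t := Finset.univ.image fun θ => isoClass (L θ))
        (fun θ _ => Finset.mem_image_of_mem (fun θ => isoClass (L θ)) (Finset.mem_univ θ))]
      refine Finset.sum_congr rfl fun c _ => ?_
      rw [Finset.sum_congr rfl (g := fun _ => FreeAlgebra.ι (Coeff k) (HGen.cls c)),
        Finset.sum_const, Nat.cast_smul_eq_nsmul]
      intro θ hθ
      rw [freeClass, (Finset.mem_filter.1 hθ).2]
    · intro c hc
      rw [Function.mem_support, h1] at hc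
      by_contra hc'
      apply hc
      rw [Finset.filter_eq_empty_iff.2, Finset.card_empty, Nat.cast_zero, mul_zero, zero_smul]
      rintro θ - rfl
      exact hc' (by simp)
  have := RingQuot.mkAlgHom_rel (Coeff k) (HRel.mul M N)
  rw [map_mul] at this
  rw [cls, cls, this, key, algHom_map_smul, algHom_map_smul, map_sum, smul_smul, div_eq_mul_inv]
  rfl

end Algebra

/-! ### Linearity over a presented algebra, and exactness on elements. -/

/-- An additive map between modules over a presented algebra is linear as soon as it commutes with
scalars and with the generators. -/
lemma map_smul_of_generators {k X : Type*} [CommRing k]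
    {r : FreeAlgebra k X → FreeAlgebra k X → Prop}
    {A B : Type*} [AddCommGroup A] [AddCommGroup B] [Module (RingQuot r) A] [Module (RingQuot r) B]
    (f : A →+ B) (hk : ∀ (c : k) (v : A), f (algebraMap k (RingQuot r) c • v) =
      algebraMap k (RingQuot r) c • f v)
    (hX : ∀ (x : X) (v : A), f (RingQuot.mkAlgHom k r (FreeAlgebra.ι k x) • v) =
      RingQuot.mkAlgHom k r (FreeAlgebra.ι k x) • f v) (y : RingQuot r) (v : A) :
    f (y • v) = y • f v := by
  obtain ⟨y, rfl⟩ := RingQuot.mkAlgHom_surjective k r y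
  induction y using FreeAlgebra.induction generalizing v with
  | grade0 c => simpa using hk c v
  | grade1 x => exact hX x v
  | mul a b ha hb => simp only [map_mul, mul_smul, ha, hb]
  | add a b ha hb => simp only [map_add, add_smul, ha, hb]

section Exact

variable {k : Type u} [Field k]

lemma ModI.exact_elementwise {S : ShortComplex (ModI k)} (hS : S.ShortExact) :
    Function.Injective S.f.hom.hom ∧ Function.Exact S.f.hom.hom S.g.hom.hom ∧
      Function.Surjective S.g.hom.hom := by
  have h := hS.map_of_exact (forget₂ (ModI k) (ModuleCat.{u} (ILambda k)))
  exact ⟨h.moduleCat_injective_f,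
    (ShortComplex.ShortExact.moduleCat_exact_iff_function_exact _).1 h.exact,
    h.moduleCat_surjective_g⟩

lemma ModI.shortExact_of_elementwise {S : ShortComplex (ModI k)}
    (h₁ : Function.Injective S.f.hom.hom) (h₂ : Function.Exact S.f.hom.hom S.g.hom.hom)
    (h₃ : Function.Surjective S.g.hom.hom) : S.ShortExact := by
  have h : (S.map (forget₂ (ModI k) (ModuleCat.{u} (ILambda k)))).ShortExact :=
    ModuleCat.shortComplex_shortExact _ h₂ h₁ h₃
  exact
    { exact := (S.exact_map_iff_of_faithful _).1 h.exact
      mono_f := Functor.mono_of_mono_map (forget₂ (ModI k) (ModuleCat.{u} (ILambda k))) h.mono_f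
      epi_g := Functor.epi_of_epi_map (forget₂ (ModI k) (ModuleCat.{u} (ILambda k))) h.epi_g }

end Exact

/-! ### Representations of the ıquiver and their modules. -/

/-- A representation of the ıquiver `1 ⟶ 2`, with a loop at each vertex. -/
structure IRep (k : Type u) [Field k] (V₁ V₂ : Type u) [AddCommGroup V₁] [AddCommGroup V₂]
    [Module k V₁] [Module k V₂] where
  a : V₁ →ₗ[k] V₂
  e₁ : V₁ →ₗ[k] V₁
  e₂ : V₂ →ₗ[k] V₂
  sq₁ : ∀ x, e₁ (e₁ x) = 0
  sq₂ : ∀ x, e₂ (e₂ x) = 0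
  comm : ∀ x, e₂ (a x) = a (e₁ x)

namespace IRep

variable {k : Type u} [Field k]
variable {V₁ V₂ : Type u} [AddCommGroup V₁] [AddCommGroup V₂] [Module k V₁] [Module k V₂]
variable {W₁ W₂ : Type u} [AddCommGroup W₁] [AddCommGroup W₂] [Module k W₁] [Module k W₂]
variable (M : IRep k V₁ V₂) (N : IRep k W₁ W₂)

/-- The action of the generators on the total space of a representation. -/
def act : IGen → Module.End k (V₁ × V₂)
  | .e .one => LinearMap.inl k V₁ V₂ ∘ₗ LinearMap.fst k V₁ V₂
  | .e .two => LinearMap.inr k V₁ V₂ ∘ₗ LinearMap.snd k V₁ V₂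
  | .α => LinearMap.inr k V₁ V₂ ∘ₗ M.a ∘ₗ LinearMap.fst k V₁ V₂
  | .ε .one => LinearMap.inl k V₁ V₂ ∘ₗ M.e₁ ∘ₗ LinearMap.fst k V₁ V₂
  | .ε .two => LinearMap.inr k V₁ V₂ ∘ₗ M.e₂ ∘ₗ LinearMap.snd k V₁ V₂

/-- The action of `Λ^ı` on the total space of a representation. -/
def action : ILambda k →ₐ[k] Module.End k (V₁ × V₂) :=
  RingQuot.liftAlgHom k ⟨FreeAlgebra.lift k M.act, by
    intro x y h
    refine LinearMap.ext fun v => ?_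
    cases h with
    | sum => simp [act]
    | idem i => cases i <;> simp [act]
    | orth i j h => cases i <;> cases j <;> simp_all [act]
    | source => simp [act]
    | target => simp [act]
    | loop_source i => cases i <;> simp [act]
    | loop_target i => cases i <;> simp [act]
    | nilp i => cases i <;> simp [act, M.sq₁, M.sq₂]
    | comm => simp [act, M.comm]⟩

lemma action_gen (x : IGen) : M.action (ILambda.gen k x) = M.act x := by
  simp [action, ILambda.gen]

variable [Module.Finite k V₁] [Module.Finite k V₂]

/-- The `Λ^ı`-module given by a representation. -/
def toMod : ModI k :=
  ⟨(ModuleCat.restrictScalars M.action.toRingHom).obj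
      (ModuleCat.of (Module.End k (V₁ × V₂)) (V₁ × V₂)), by
    let _ : Module (ILambda k) (V₁ × V₂) := Module.compHom (V₁ × V₂) M.action.toRingHom
    have : IsScalarTower k (ILambda k) (V₁ × V₂) := ⟨fun c x v => by
      change M.action (c • x) v = c • M.action x v
      rw [map_smul, LinearMap.smul_apply]⟩
    exact (Module.Finite.of_restrictScalars_finite k (ILambda k) (V₁ × V₂) :)⟩

/-- A vector of a representation, as an element of the associated module. -/
def elt : V₁ × V₂ ≃+ M.toMod.obj := AddEquiv.refl (V₁ × V₂)

@[simp]
lemma gen_smul_elt (x : IGen) (v : V₁ × V₂) : ILambda.gen k x • M.elt v = M.elt (M.act x v) := by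
  rw [← action_gen]; rfl

@[simp]
lemma algebraMap_smul_elt (c : k) (v : V₁ × V₂) :
    algebraMap k (ILambda k) c • M.elt v = M.elt (c • v) := by
  change M.action (algebraMap k (ILambda k) c) v = c • v
  rw [AlgHom.commutes]; rfl

variable {M} in
/-- The data of a morphism from the module of a representation to an arbitrary module. -/
structure IsDesc (M : IRep k V₁ V₂) (L : ModI k) (s₁ : V₁ →+ L.obj) (s₂ : V₂ →+ L.obj) : Prop where
  smul₁ : ∀ (c : k) x, s₁ (c • x) = algebraMap k (ILambda k) c • s₁ x
  smul₂ : ∀ (c : k) x, s₂ (c • x) = algebraMap k (ILambda k) c • s₂ x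
  vert₁ : ∀ x, ILambda.gen k (.e .one) • s₁ x = s₁ x
  vert₂ : ∀ x, ILambda.gen k (.e .two) • s₂ x = s₂ x
  arrow : ∀ x, ILambda.gen k .α • s₁ x = s₂ (M.a x)
  loop₁ : ∀ x, ILambda.gen k (.ε .one) • s₁ x = s₁ (M.e₁ x)
  loop₂ : ∀ x, ILambda.gen k (.ε .two) • s₂ x = s₂ (M.e₂ x)

/-- The additive map underlying a morphism from the module of a representation. -/
def descAdd {L : ModI k} (s₁ : V₁ →+ L.obj) (s₂ : V₂ →+ L.obj) : M.toMod.obj →+ L.obj :=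
  (AddMonoidHom.coprod s₁ s₂).comp M.elt.symm.toAddMonoidHom

@[simp]
lemma descAdd_elt {L : ModI k} (s₁ : V₁ →+ L.obj) (s₂ : V₂ →+ L.obj) (v : V₁ × V₂) :
    M.descAdd s₁ s₂ (M.elt v) = s₁ v.1 + s₂ v.2 := rfl

variable {M} in
-- By `map_smul_of_generators` only the generators matter. The images of s₁ and s₂ lie in e₁L and
-- e₂L, so a generator starting at one vertex kills the part coming from the other vertex; the
-- fields of `IsDesc` cover what is left.
lemma IsDesc.map_smul {L : ModI k} {s₁ : V₁ →+ L.obj} {s₂ : V₂ →+ L.obj} (h : M.IsDesc L s₁ s₂)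
    (y : ILambda k) (v : M.toMod.obj) : M.descAdd s₁ s₂ (y • v) = y • M.descAdd s₁ s₂ v := by
  refine map_smul_of_generators (k := k) (r := IRel k) (M.descAdd s₁ s₂) (fun c v => ?_)
    (fun x v => ?_) y v
  · obtain ⟨v, rfl⟩ := M.elt.surjective v
    rw [algebraMap_smul_elt, descAdd_elt, descAdd_elt, Prod.smul_fst, Prod.smul_snd,
      h.smul₁, h.smul₂, smul_add]
  · obtain ⟨v, rfl⟩ := M.elt.surjective v
    change M.descAdd s₁ s₂ (ILambda.gen k x • M.elt v) = ILambda.gen k x • _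
    rw [gen_smul_elt, descAdd_elt, descAdd_elt]
    obtain ⟨-, idem, orth, src, tgt, lsrc, ltgt, nil, com⟩ := gen_rels (k := k)
    have h₁ : ∀ x z, z * ILambda.gen k (.e .one) = 0 → z • s₁ x = 0 := fun x z hz => by
      rw [← h.vert₁, ← mul_smul, hz, zero_smul]
    have h₂ : ∀ x z, z * ILambda.gen k (.e .two) = 0 → z • s₂ x = 0 := fun x z hz => by
      rw [← h.vert₂, ← mul_smul, hz, zero_smul]
    have o12 := orth .one .two (by simp)
    have o21 := orth .two .one (by simp)
    rcases x with (_ | _) | _ | (_ | _)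
    · rw [smul_add, h.vert₁, h₂ _ _ o12]; simp [act]
    · rw [smul_add, h.vert₂, h₁ _ _ o21]; simp [act]
    · rw [smul_add, h.arrow, h₂ _ _ (by rw [← src, mul_assoc, o12, mul_zero])]; simp [act]
    · rw [smul_add, h.loop₁, h₂ _ _ (by rw [← lsrc, mul_assoc, o12, mul_zero])]; simp [act]
    · rw [smul_add, h.loop₂, h₁ _ _ (by rw [← lsrc, mul_assoc, o21, mul_zero])]
      simp [act]

/-- A morphism from the module of a representation to an arbitrary module. -/
def desc {L : ModI k} {s₁ : V₁ →+ L.obj} {s₂ : V₂ →+ L.obj} (h : M.IsDesc L s₁ s₂) :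
    M.toMod ⟶ L :=
  ObjectProperty.homMk (ModuleCat.ofHom (X := M.toMod.obj) (Y := L.obj)
    { M.descAdd s₁ s₂ with map_smul' := h.map_smul })

lemma desc_elt {L : ModI k} {s₁ : V₁ →+ L.obj} {s₂ : V₂ →+ L.obj} (h : M.IsDesc L s₁ s₂)
    (v : V₁ × V₂) : (M.desc h).hom.hom (M.elt v) = s₁ v.1 + s₂ v.2 := rfl

variable [Module.Finite k W₁] [Module.Finite k W₂]

/-- A morphism of representations. -/
structure IsHom (f₁ : V₁ →ₗ[k] W₁) (f₂ : V₂ →ₗ[k] W₂) : Prop where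
  arrow : ∀ x, N.a (f₁ x) = f₂ (M.a x)
  loop₁ : ∀ x, N.e₁ (f₁ x) = f₁ (M.e₁ x)
  loop₂ : ∀ x, N.e₂ (f₂ x) = f₂ (M.e₂ x)

variable {M N}

lemma IsHom.isDesc {f₁ : V₁ →ₗ[k] W₁} {f₂ : V₂ →ₗ[k] W₂} (h : M.IsHom N f₁ f₂) :
    M.IsDesc N.toMod (N.elt.toAddMonoidHom.comp (LinearMap.inl k W₁ W₂ ∘ₗ f₁).toAddMonoidHom)
      (N.elt.toAddMonoidHom.comp (LinearMap.inr k W₁ W₂ ∘ₗ f₂).toAddMonoidHom) where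
  smul₁ c x := by
    refine Eq.trans ?_ (N.algebraMap_smul_elt c (f₁ x, 0)).symm
    simp
  smul₂ c x := by
    refine Eq.trans ?_ (N.algebraMap_smul_elt c (0, f₂ x)).symm
    simp
  vert₁ x := (N.gen_smul_elt _ (f₁ x, 0)).trans (by simp [act])
  vert₂ x := (N.gen_smul_elt _ (0, f₂ x)).trans (by simp [act])
  arrow x := (N.gen_smul_elt _ (f₁ x, 0)).trans (by simp [act, h.arrow])
  loop₁ x := (N.gen_smul_elt _ (f₁ x, 0)).trans (by simp [act, h.loop₁])
  loop₂ x := (N.gen_smul_elt _ (0, f₂ x)).trans (by simp [act, h.loop₂])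

/-- The morphism of modules induced by a morphism of representations. -/
def IsHom.map {f₁ : V₁ →ₗ[k] W₁} {f₂ : V₂ →ₗ[k] W₂} (h : M.IsHom N f₁ f₂) : M.toMod ⟶ N.toMod :=
  M.desc h.isDesc

lemma IsHom.map_elt {f₁ : V₁ →ₗ[k] W₁} {f₂ : V₂ →ₗ[k] W₂} (h : M.IsHom N f₁ f₂) (v : V₁ × V₂) :
    h.map.hom.hom (M.elt v) = N.elt (f₁ v.1, f₂ v.2) := by
  rw [IsHom.map, desc_elt]
  change N.elt (f₁ v.1, 0) + N.elt (0, f₂ v.2) = _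
  rw [← map_add]
  simp

lemma hom_ext {L : ModI k} {f g : M.toMod ⟶ L}
    (h : ∀ v, f.hom.hom (M.elt v) = g.hom.hom (M.elt v)) : f = g := by
  ext v; exact h v

/-- Commuting with the idempotents e₁, e₂ makes a module map block diagonal; commuting with α, ε₁,
ε₂ then gives the three equations of `IsHom` for its blocks. -/
lemma exists_isHom (f : M.toMod ⟶ N.toMod) :
    ∃ (f₁ : V₁ →ₗ[k] W₁) (f₂ : V₂ →ₗ[k] W₂) (h : M.IsHom N f₁ f₂), f = h.map := by
  let F : V₁ × V₂ →ₗ[k] W₁ × W₂ :=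
    { toFun := fun v => f.hom.hom (M.elt v)
      map_add' := fun v w => map_add f.hom.hom (M.elt v) (M.elt w)
      map_smul' := fun c v => by
        rw [← algebraMap_smul_elt, map_smul]
        exact N.algebraMap_smul_elt c _ }
  have hF : ∀ x v, F (M.act x v) = N.act x (F v) := fun x v => by
    change f.hom.hom (M.elt (M.act x v)) = _
    rw [← gen_smul_elt, map_smul]
    exact N.gen_smul_elt x _
  -- The off-diagonal blocks of F vanish.
  have h1 : ∀ x, F (x, 0) = ((F (x, 0)).1, 0) := fun x => by
    simpa [act] using hF (.e .one) (x, 0)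
  have h2 : ∀ x, F (0, x) = (0, (F (0, x)).2) := fun x => by
    simpa [act] using hF (.e .two) (0, x)
  refine ⟨LinearMap.fst k _ _ ∘ₗ F ∘ₗ LinearMap.inl k _ _,
    LinearMap.snd k _ _ ∘ₗ F ∘ₗ LinearMap.inr k _ _, ⟨fun x => ?_, fun x => ?_, fun x => ?_⟩, ?_⟩
  · simpa [act] using (congrArg Prod.snd (hF .α (x, 0))).symm
  · simpa [act] using (congrArg Prod.fst (hF (.ε .one) (x, 0))).symm
  · simpa [act] using (congrArg Prod.snd (hF (.ε .two) (0, x))).symm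
  · refine hom_ext fun v => ?_
    rw [IsHom.map_elt]
    change F v = ((F (v.1, 0)).1, (F (0, v.2)).2)
    have : F v = F (v.1, 0) + F (0, v.2) := by rw [← map_add]; simp
    rw [this, h1, h2]; simp

lemma IsHom.map_injective {f₁ g₁ : V₁ →ₗ[k] W₁} {f₂ g₂ : V₂ →ₗ[k] W₂} (h : M.IsHom N f₁ f₂)
    (h' : M.IsHom N g₁ g₂) (e : h.map = h'.map) : f₁ = g₁ ∧ f₂ = g₂ := by
  have key : ∀ v : V₁ × V₂, ((f₁ v.1, f₂ v.2) : W₁ × W₂) = (g₁ v.1, g₂ v.2) := fun v => by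
    have := congrArg (fun f => f.hom.hom (M.elt v)) e
    simp only [IsHom.map_elt] at this
    exact this
  exact ⟨LinearMap.ext fun x => congrArg Prod.fst (key (x, 0)),
    LinearMap.ext fun x => congrArg Prod.snd (key (0, x))⟩

variable (M N) in
/-- Morphisms between the modules of two representations. -/
def homEquiv : (M.toMod ⟶ N.toMod) ≃
    {p : (V₁ →ₗ[k] W₁) × (V₂ →ₗ[k] W₂) // M.IsHom N p.1 p.2} :=
  (Equiv.ofBijective (fun p : {p : (V₁ →ₗ[k] W₁) × (V₂ →ₗ[k] W₂) // M.IsHom N p.1 p.2} => p.2.map)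
    ⟨fun p q h => by
      obtain ⟨h₁, h₂⟩ := IsHom.map_injective p.2 q.2 h
      exact Subtype.ext (Prod.ext h₁ h₂), fun f => by
      obtain ⟨f₁, f₂, h, rfl⟩ := exists_isHom f
      exact ⟨⟨(f₁, f₂), h⟩, rfl⟩⟩).symm

/-- Isomorphic representations give isomorphic modules. -/
lemma isoClass_eq (f₁ : V₁ ≃ₗ[k] W₁) (f₂ : V₂ ≃ₗ[k] W₂)
    (h : M.IsHom N f₁.toLinearMap f₂.toLinearMap) : isoClass M.toMod = isoClass N.toMod := by
  have h' : N.IsHom M f₁.symm.toLinearMap f₂.symm.toLinearMap :=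
    ⟨fun x => f₂.injective (by simpa using (h.arrow (f₁.symm x)).symm),
      fun x => f₁.injective (by simpa using (h.loop₁ (f₁.symm x)).symm),
      fun x => f₂.injective (by simpa using (h.loop₂ (f₂.symm x)).symm)⟩
  refine isoClass_eq_iff.2 ⟨⟨h.map, h'.map, hom_ext fun v => ?_, hom_ext fun v => ?_⟩⟩
  · change h'.map.hom.hom (h.map.hom.hom (M.elt v)) = M.elt v
    simp [IsHom.map_elt]
  · change h.map.hom.hom (h'.map.hom.hom (N.elt v)) = N.elt v
    simp [IsHom.map_elt]

lemma shortExact_of_isHom {U₁ U₂ : Type u} [AddCommGroup U₁] [AddCommGroup U₂] [Module k U₁]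
    [Module k U₂] [Module.Finite k U₁] [Module.Finite k U₂] {L : IRep k U₁ U₂}
    {i₁ : V₁ →ₗ[k] U₁} {i₂ : V₂ →ₗ[k] U₂} {p₁ : U₁ →ₗ[k] W₁} {p₂ : U₂ →ₗ[k] W₂}
    (hi : M.IsHom L i₁ i₂) (hp : L.IsHom N p₁ p₂) (inj₁ : Function.Injective i₁)
    (inj₂ : Function.Injective i₂) (ex₁ : Function.Exact i₁ p₁) (ex₂ : Function.Exact i₂ p₂)
    (surj₁ : Function.Surjective p₁) (surj₂ : Function.Surjective p₂) :
    ∃ zero : hi.map ≫ hp.map = 0, (ShortComplex.mk hi.map hp.map zero).ShortExact := by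
  have zero : hi.map ≫ hp.map = 0 := hom_ext fun v => by
    change hp.map.hom.hom (hi.map.hom.hom (M.elt v)) = N.elt (0, 0)
    simp [IsHom.map_elt, ex₁.apply_apply_eq_zero, ex₂.apply_apply_eq_zero]
  refine ⟨zero, ModI.shortExact_of_elementwise ?_ ?_ ?_⟩
  · intro v w hvw
    have hvw' : L.elt _ = L.elt _ := (hi.map_elt v).symm.trans (hvw.trans (hi.map_elt w))
    exact Prod.ext (inj₁ (congrArg Prod.fst hvw')) (inj₂ (congrArg Prod.snd hvw'))
  · intro v
    constructor
    · intro hv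
      have hv' : N.elt (p₁ _, p₂ _) = N.elt (0, 0) := (hp.map_elt v).symm.trans hv
      obtain ⟨x, hx⟩ := (ex₁ _).1 (congrArg Prod.fst hv')
      obtain ⟨y, hy⟩ := (ex₂ _).1 (congrArg Prod.snd hv')
      exact ⟨M.elt (x, y), (hi.map_elt _).trans (Prod.ext hx hy)⟩
    · rintro ⟨w, rfl⟩
      exact congrArg (fun f => f.hom.hom (M.elt w)) zero
  · intro w
    obtain ⟨x, hx⟩ := surj₁ (w : W₁ × W₂).1
    obtain ⟨y, hy⟩ := surj₂ (w : W₁ × W₂).2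
    exact ⟨L.elt (x, y), (hp.map_elt _).trans (Prod.ext hx hy)⟩

end IRep

/-! ### Extensions of representations as cocycles modulo coboundaries. -/

lemma Extension.Equivalent.trans {C : Type u} [Category.{v} C] [Abelian C] {M N L L' L'' : C}
    {E : Extension M N L} {E' : Extension M N L'} {E'' : Extension M N L''}
    (h : E.Equivalent E') (h' : E'.Equivalent E'') : E.Equivalent E'' := by
  obtain ⟨φ, h₁, h₂⟩ := h
  obtain ⟨ψ, h₃, h₄⟩ := h'
  exact ⟨φ ≪≫ ψ, by simp [← h₃, ← h₁], by simp [h₄, h₂]⟩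

/-- The short five lemma: a morphism of middle terms inducing identities on the ends is invertible.
-/
lemma Extension.equivalent_of_hom {C : Type u} [Category.{v} C] [Abelian C] {M N L L' : C}
    {E : Extension M N L} {E' : Extension M N L'} (φ : L ⟶ L') (h₁ : E.incl ≫ φ = E'.incl)
    (h₂ : φ ≫ E'.proj = E.proj) : E.Equivalent E' := by
  have : IsIso φ := ShortComplex.isIso₂_of_shortExact_of_isIso₁₃'
    (S₁ := .mk _ _ E.zero) (S₂ := .mk _ _ E'.zero)
    { τ₁ := 𝟙 N, τ₂ := φ, τ₃ := 𝟙 M, comm₁₂ := by simp [h₁], comm₂₃ := by simp [h₂] }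
    E.shortExact E'.shortExact (IsIso.id N) (IsIso.id M)
  exact ⟨asIso φ, h₁, h₂⟩

namespace IRep

variable {k : Type u} [Field k]
variable {V₁ V₂ : Type u} [AddCommGroup V₁] [AddCommGroup V₂] [Module k V₁] [Module k V₂]
variable {W₁ W₂ : Type u} [AddCommGroup W₁] [AddCommGroup W₂] [Module k W₁] [Module k W₂]

/-- A cocycle describing an extension of the representation `M` by the representation `N`. -/
structure Cocycle (M : IRep k V₁ V₂) (N : IRep k W₁ W₂) where
  a : V₁ →ₗ[k] W₂
  e₁ : V₁ →ₗ[k] W₁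
  e₂ : V₂ →ₗ[k] W₂
  sq₁ : ∀ x, N.e₁ (e₁ x) + e₁ (M.e₁ x) = 0
  sq₂ : ∀ x, N.e₂ (e₂ x) + e₂ (M.e₂ x) = 0
  comm : ∀ x, N.e₂ (a x) + e₂ (M.a x) = N.a (e₁ x) + a (M.e₁ x)

variable {M : IRep k V₁ V₂} {N : IRep k W₁ W₂}

/-- The middle term of the extension described by a cocycle. -/
def Cocycle.ext (c : Cocycle M N) : IRep k (W₁ × V₁) (W₂ × V₂) where
  a := (N.a ∘ₗ LinearMap.fst k W₁ V₁ + c.a ∘ₗ LinearMap.snd k W₁ V₁).prod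
    (M.a ∘ₗ LinearMap.snd k W₁ V₁)
  e₁ := (N.e₁ ∘ₗ LinearMap.fst k W₁ V₁ + c.e₁ ∘ₗ LinearMap.snd k W₁ V₁).prod
    (M.e₁ ∘ₗ LinearMap.snd k W₁ V₁)
  e₂ := (N.e₂ ∘ₗ LinearMap.fst k W₂ V₂ + c.e₂ ∘ₗ LinearMap.snd k W₂ V₂).prod
    (M.e₂ ∘ₗ LinearMap.snd k W₂ V₂)
  sq₁ x := by simp [N.sq₁, M.sq₁, c.sq₁]
  sq₂ x := by simp [N.sq₂, M.sq₂, c.sq₂]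
  comm x := by simp [N.comm, M.comm, c.comm, add_assoc]

lemma Cocycle.ext_a (c : Cocycle M N) (x : W₁ × V₁) :
    c.ext.a x = (N.a x.1 + c.a x.2, M.a x.2) := rfl

lemma Cocycle.ext_e₁ (c : Cocycle M N) (x : W₁ × V₁) :
    c.ext.e₁ x = (N.e₁ x.1 + c.e₁ x.2, M.e₁ x.2) := rfl

lemma Cocycle.ext_e₂ (c : Cocycle M N) (x : W₂ × V₂) :
    c.ext.e₂ x = (N.e₂ x.1 + c.e₂ x.2, M.e₂ x.2) := rfl

/-- The shear automorphism of a direct sum. -/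
def shear (h : V₁ →ₗ[k] W₁) : W₁ × V₁ →ₗ[k] W₁ × V₁ :=
  (LinearMap.fst k W₁ V₁ + h ∘ₗ LinearMap.snd k W₁ V₁).prod (LinearMap.snd k W₁ V₁)

lemma shear_apply (h : V₁ →ₗ[k] W₁) (x : W₁ × V₁) : shear h x = (x.1 + h x.2, x.2) := rfl

/-- Two cocycles are cohomologous if they differ by a coboundary. -/
def Cocycle.Cohomologous (c c' : Cocycle M N) : Prop :=
  ∃ (h₁ : V₁ →ₗ[k] W₁) (h₂ : V₂ →ₗ[k] W₂),
    (∀ x, c'.a x + N.a (h₁ x) = c.a x + h₂ (M.a x)) ∧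
    (∀ x, c'.e₁ x + N.e₁ (h₁ x) = c.e₁ x + h₁ (M.e₁ x)) ∧
    (∀ x, c'.e₂ x + N.e₂ (h₂ x) = c.e₂ x + h₂ (M.e₂ x))

lemma Cocycle.isHom_incl (c : Cocycle M N) :
    N.IsHom c.ext (LinearMap.inl k W₁ V₁) (LinearMap.inl k W₂ V₂) := by
  constructor <;> intro x <;> simp [Cocycle.ext]

lemma Cocycle.isHom_proj (c : Cocycle M N) :
    c.ext.IsHom M (LinearMap.snd k W₁ V₁) (LinearMap.snd k W₂ V₂) := by
  constructor <;> intro x <;> simp [Cocycle.ext]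

variable [Module.Finite k V₁] [Module.Finite k V₂] [Module.Finite k W₁] [Module.Finite k W₂]

/-- The extension of modules described by a cocycle. -/
def Cocycle.extension (c : Cocycle M N) : Extension M.toMod N.toMod c.ext.toMod :=
  have h := shortExact_of_isHom c.isHom_incl c.isHom_proj LinearMap.inl_injective
    LinearMap.inl_injective (Function.Exact.inl_snd) (Function.Exact.inl_snd)
    LinearMap.snd_surjective LinearMap.snd_surjective
  { incl := c.isHom_incl.map
    proj := c.isHom_proj.map
    zero := h.1
    shortExact := h.2 }

/-- The coboundary equations say exactly that the unipotent maps `shear h₁`, `shear h₂` intertwine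
the two block-triangular structures. -/
lemma Cocycle.Cohomologous.equivalent {c c' : Cocycle M N} (h : c.Cohomologous c') :
    c.extension.Equivalent c'.extension := by
  obtain ⟨h₁, h₂, ha, h1, h2⟩ := h
  have hom : c.ext.IsHom c'.ext (shear h₁) (shear h₂) := by
    constructor <;> intro x
    · rw [shear_apply, shear_apply, Cocycle.ext_a, Cocycle.ext_a, map_add, add_assoc, add_assoc,
        add_comm (N.a _) (c'.a _), ha]
    · rw [shear_apply, shear_apply, Cocycle.ext_e₁, Cocycle.ext_e₁, map_add, add_assoc, add_assoc,
        add_comm (N.e₁ _) (c'.e₁ _), h1]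
    · rw [shear_apply, shear_apply, Cocycle.ext_e₂, Cocycle.ext_e₂, map_add, add_assoc, add_assoc,
        add_comm (N.e₂ _) (c'.e₂ _), h2]
  refine Extension.equivalent_of_hom hom.map (IRep.hom_ext fun v => ?_) (IRep.hom_ext fun v => ?_)
  · change hom.map.hom.hom (c.isHom_incl.map.hom.hom (N.elt v)) =
      c'.isHom_incl.map.hom.hom (N.elt v)
    simp [IsHom.map_elt, shear_apply]
  · change c'.isHom_proj.map.hom.hom (hom.map.hom.hom (c.ext.elt v)) =
      c.isHom_proj.map.hom.hom (c.ext.elt v)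
    simp [IsHom.map_elt, shear_apply]

/-- An equivalence is the identity on N and modulo N, so at each vertex it is a shear. Its
off-diagonal entries are the required h₁ and h₂, and the intertwining equations are the coboundary
equations. -/
lemma Cocycle.cohomologous_of_equivalent {c c' : Cocycle M N}
    (h : c.extension.Equivalent c'.extension) : c.Cohomologous c' := by
  obtain ⟨φ, h₁, h₂⟩ := h
  obtain ⟨f₁, f₂, hf, hφ⟩ := exists_isHom φ.hom
  rw [hφ] at h₁ h₂
  have key₁ : ∀ v : W₁ × W₂, c'.ext.elt (f₁ (v.1, 0), f₂ (v.2, 0)) =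
      c'.ext.elt ((v.1, 0), (v.2, 0)) := fun v => by
    have h : hf.map.hom.hom (c.isHom_incl.map.hom.hom (N.elt v)) =
      c'.isHom_incl.map.hom.hom (N.elt v) := congrArg (fun f => f.hom.hom (N.elt v)) h₁
    simp only [IsHom.map_elt] at h
    exact h
  have key₂ : ∀ v : (W₁ × V₁) × (W₂ × V₂), M.elt ((f₁ v.1).2, (f₂ v.2).2) =
      M.elt (v.1.2, v.2.2) := fun v => by
    have h : c'.isHom_proj.map.hom.hom (hf.map.hom.hom (c.ext.elt v)) =
      c.isHom_proj.map.hom.hom (c.ext.elt v) := congrArg (fun f => f.hom.hom (c.ext.elt v)) h₂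
    simp only [IsHom.map_elt] at h
    exact h
  simp only [EmbeddingLike.apply_eq_iff_eq, Prod.mk.injEq] at key₁ key₂
  have i₁ : ∀ x, f₁ (x, 0) = (x, 0) := fun x => (key₁ (x, 0)).1
  have i₂ : ∀ x, f₂ (x, 0) = (x, 0) := fun x => (key₁ (0, x)).2
  have e₁ : ∀ x y, f₁ (x, y) = (x + (f₁ (0, y)).1, y) := fun x y => by
    refine Prod.ext ?_ (key₂ ((x, y), 0)).1
    have : f₁ (x, y) = f₁ (x, 0) + f₁ (0, y) := by rw [← map_add]; simp
    rw [this, i₁]; rfl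
  have e₂ : ∀ x y, f₂ (x, y) = (x + (f₂ (0, y)).1, y) := fun x y => by
    refine Prod.ext ?_ (key₂ (0, (x, y))).2
    have : f₂ (x, y) = f₂ (x, 0) + f₂ (0, y) := by rw [← map_add]; simp
    rw [this, i₂]; rfl
  refine ⟨LinearMap.fst k _ _ ∘ₗ f₁ ∘ₗ LinearMap.inr k _ _,
    LinearMap.fst k _ _ ∘ₗ f₂ ∘ₗ LinearMap.inr k _ _, fun x => ?_, fun x => ?_, fun x => ?_⟩
  · have := congrArg Prod.fst (hf.arrow (0, x))
    rw [e₁] at this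
    rw [Cocycle.ext_a, Cocycle.ext_a, e₂] at this
    simpa [add_comm] using this
  · have := congrArg Prod.fst (hf.loop₁ (0, x))
    rw [e₁] at this
    rw [Cocycle.ext_e₁, Cocycle.ext_e₁, e₁ (_ + _)] at this
    simpa [add_comm] using this
  · have := congrArg Prod.fst (hf.loop₂ (0, x))
    rw [e₂] at this
    rw [Cocycle.ext_e₂, Cocycle.ext_e₂, e₂ (_ + _)] at this
    simpa [add_comm] using this

/-- Every extension of `M` by `N` splits vertexwise, with a cocycle measuring the failure of the
sections to be equivariant. -/
lemma exists_cocycle_sections {L : ModI k} (E : Extension M.toMod N.toMod L) :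
    ∃ (s₁ : V₁ →+ L.obj) (s₂ : V₂ →+ L.obj) (c : Cocycle M N),
      (∀ (t : k) x, s₁ (t • x) = algebraMap k (ILambda k) t • s₁ x) ∧
      (∀ (t : k) x, s₂ (t • x) = algebraMap k (ILambda k) t • s₂ x) ∧
      (∀ x, ILambda.gen k (.e .one) • s₁ x = s₁ x) ∧
      (∀ x, ILambda.gen k (.e .two) • s₂ x = s₂ x) ∧
      (∀ x, E.proj.hom.hom (s₁ x) = M.elt (x, 0)) ∧ (∀ x, E.proj.hom.hom (s₂ x) = M.elt (0, x)) ∧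
      (∀ x, ILambda.gen k .α • s₁ x = E.incl.hom.hom (N.elt (0, c.a x)) + s₂ (M.a x)) ∧
      (∀ x, ILambda.gen k (.ε .one) • s₁ x =
        E.incl.hom.hom (N.elt (c.e₁ x, 0)) + s₁ (M.e₁ x)) ∧
      (∀ x, ILambda.gen k (.ε .two) • s₂ x =
        E.incl.hom.hom (N.elt (0, c.e₂ x)) + s₂ (M.e₂ x)) := by
  obtain ⟨-, idem, orth, src, tgt, lsrc, ltgt, nil, com⟩ := gen_rels (k := k)
  obtain ⟨inj, ex, surj⟩ := ModI.exact_elementwise E.shortExact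
  let _ : Module k L.obj := Module.compHom L.obj (algebraMap k (ILambda k))
  let p : L.obj →ₗ[k] V₁ × V₂ :=
    { toFun := fun l => M.elt.symm (E.proj.hom.hom l)
      map_add' := fun x y => by rw [map_add, map_add]
      map_smul' := fun t x => M.elt.injective (by
        rw [AddEquiv.apply_symm_apply, RingHom.id_apply, ← algebraMap_smul_elt,
          AddEquiv.apply_symm_apply]
        exact map_smul E.proj.hom.hom _ _) }
  let i : W₁ × W₂ →ₗ[k] L.obj :=
    { toFun := fun w => E.incl.hom.hom (N.elt w)
      map_add' := fun x y => by rw [map_add, map_add]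
      map_smul' := fun t x => by
        rw [← algebraMap_smul_elt]
        exact map_smul E.incl.hom.hom _ _ }
  have hp : ∀ l, M.elt (p l) = E.proj.hom.hom l := fun l => M.elt.apply_symm_apply _
  have hpsurj : Function.Surjective p := fun v => by
    obtain ⟨l, hl⟩ := surj (M.elt v)
    exact ⟨l, M.elt.injective ((hp l).trans hl)⟩
  have hiinj : Function.Injective i := fun v w h => N.elt.injective (inj h)
  -- Over the field k the sequence splits: σ is a section of the projection and r a retraction of
  -- the inclusion, neither of them equivariant.
  obtain ⟨σ, hσ⟩ := p.exists_rightInverse_of_surjective (LinearMap.range_eq_top.2 hpsurj)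
  obtain ⟨r, hr⟩ := i.exists_leftInverse_of_injective (LinearMap.ker_eq_bot.2 hiinj)
  have hri : ∀ l, p l = 0 → i (r l) = l := fun l hl => by
    obtain ⟨w, hw⟩ := (ex l).1 ((hp l).symm.trans (by rw [hl]; exact map_zero M.elt))
    obtain ⟨w, rfl⟩ := N.elt.surjective w
    have hw : i w = l := hw
    rw [← hw]
    exact congrArg i (LinearMap.congr_fun hr w)
  let g : IGen → L.obj →ₗ[k] L.obj := fun x =>
    { toFun := fun l => ILambda.gen k x • l
      map_add' := fun l l' => smul_add _ _ _
      map_smul' := fun t l => by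
        change ILambda.gen k x • algebraMap k (ILambda k) t • l =
          algebraMap k (ILambda k) t • ILambda.gen k x • l
        rw [← mul_smul, ← mul_smul, Algebra.commutes] }
  have gg : ∀ x y l, g x (g y l) = (ILambda.gen k x * ILambda.gen k y) • l := fun x y l =>
    (mul_smul _ _ _).symm
  have pg : ∀ x l, p (g x l) = M.act x (p l) := fun x l => M.elt.injective (by
    rw [hp, ← gen_smul_elt, hp]; exact map_smul E.proj.hom.hom _ _)
  have ig : ∀ x w, i (N.act x w) = g x (i w) := fun x w => by
    change E.incl.hom.hom (N.elt (N.act x w)) = _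
    rw [← gen_smul_elt]; exact map_smul E.incl.hom.hom _ _
  -- Multiplying σ by the vertex idempotents makes it respect the vertices; it stays a section,
  -- since the projection commutes with them.
  let s₁ : V₁ →ₗ[k] L.obj := g (.e .one) ∘ₗ σ ∘ₗ LinearMap.inl k V₁ V₂
  let s₂ : V₂ →ₗ[k] L.obj := g (.e .two) ∘ₗ σ ∘ₗ LinearMap.inr k V₁ V₂
  have pσ : ∀ v, p (σ v) = v := fun v => LinearMap.congr_fun hσ v
  have ps₁ : ∀ x, p (s₁ x) = (x, 0) := fun x => by simp [s₁, pg, pσ, act]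
  have ps₂ : ∀ x, p (s₂ x) = (0, x) := fun x => by simp [s₂, pg, pσ, act]
  have gs₁ : ∀ x, g (.e .one) (s₁ x) = s₁ x := fun x => by
    simp only [s₁, LinearMap.comp_apply, gg, idem]; rfl
  have gs₂ : ∀ x, g (.e .two) (s₂ x) = s₂ x := fun x => by
    simp only [s₂, LinearMap.comp_apply, gg, idem]; rfl
  -- An element of the kernel that lies in e₁L comes from the vertex 1 part of N.
  have fix₁ : ∀ l, p l = 0 → g (.e .one) l = l → i ((r l).1, 0) = l := fun l hl hl' => by
    conv_rhs => rw [← hl', ← hri l hl, ← ig]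
    simp [act]
  have fix₂ : ∀ l, p l = 0 → g (.e .two) l = l → i (0, (r l).2) = l := fun l hl hl' => by
    conv_rhs => rw [← hl', ← hri l hl, ← ig]
    simp [act]
  -- These defects of equivariance take values in the kernel of the projection, at the vertex where
  -- the arrow or loop ends, so they come from linear maps into W₁ or W₂: the cocycle.
  let da : V₁ →ₗ[k] L.obj := g .α ∘ₗ s₁ - s₂ ∘ₗ M.a
  let d₁ : V₁ →ₗ[k] L.obj := g (.ε .one) ∘ₗ s₁ - s₁ ∘ₗ M.e₁
  let d₂ : V₂ →ₗ[k] L.obj := g (.ε .two) ∘ₗ s₂ - s₂ ∘ₗ M.e₂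
  let ca : V₁ →ₗ[k] W₂ := LinearMap.snd k W₁ W₂ ∘ₗ r ∘ₗ da
  let c₁ : V₁ →ₗ[k] W₁ := LinearMap.fst k W₁ W₂ ∘ₗ r ∘ₗ d₁
  let c₂ : V₂ →ₗ[k] W₂ := LinearMap.snd k W₁ W₂ ∘ₗ r ∘ₗ d₂
  have ha : ∀ x, g .α (s₁ x) = i (0, ca x) + s₂ (M.a x) := fun x => by
    rw [← sub_eq_iff_eq_add]
    refine (fix₂ (da x) ?_ ?_).symm
    · simp [da, pg, ps₁, ps₂, act]
    · simp only [da, LinearMap.sub_apply, LinearMap.comp_apply, map_sub, gs₂, gg, tgt]; rfl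
  have h1 : ∀ x, g (.ε .one) (s₁ x) = i (c₁ x, 0) + s₁ (M.e₁ x) := fun x => by
    rw [← sub_eq_iff_eq_add]
    refine (fix₁ (d₁ x) ?_ ?_).symm
    · simp [d₁, pg, ps₁, act]
    · simp only [d₁, LinearMap.sub_apply, LinearMap.comp_apply, map_sub, gs₁, gg, ltgt]; rfl
  have h2 : ∀ x, g (.ε .two) (s₂ x) = i (0, c₂ x) + s₂ (M.e₂ x) := fun x => by
    rw [← sub_eq_iff_eq_add]
    refine (fix₂ (d₂ x) ?_ ?_).symm
    · simp [d₂, pg, ps₂, act]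
    · simp only [d₂, LinearMap.sub_apply, LinearMap.comp_apply, map_sub, gs₂, gg, ltgt]; rfl
  refine ⟨s₁.toAddMonoidHom, s₂.toAddMonoidHom, ⟨ca, c₁, c₂, fun x => ?_, fun x => ?_, fun x => ?_⟩,
    s₁.map_smul, s₂.map_smul, gs₁, gs₂, fun x => (hp _).symm.trans (congrArg M.elt (ps₁ x)),
    fun x => (hp _).symm.trans (congrArg M.elt (ps₂ x)), ha, h1, h2⟩
  -- The three cocycle identities express ε₁² = 0, ε₂² = 0 and ε₂α = αε₁ on the sections, after
  -- cancelling the injective map i.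
  · have h : g (.ε .one) (g (.ε .one) (s₁ x)) = 0 := by rw [gg, nil, zero_smul]
    rw [h1, map_add, h1, M.sq₁, map_zero, add_zero, ← ig, ← map_add] at h
    simpa [act] using hiinj (h.trans (map_zero i).symm)
  · have h : g (.ε .two) (g (.ε .two) (s₂ x)) = 0 := by rw [gg, nil, zero_smul]
    rw [h2, map_add, h2, M.sq₂, map_zero, add_zero, ← ig, ← map_add] at h
    simpa [act] using hiinj (h.trans (map_zero i).symm)
  · have h : g (.ε .two) (g .α (s₁ x)) = g .α (g (.ε .one) (s₁ x)) := by rw [gg, gg, com]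
    rw [ha, map_add, h2, h1, map_add, ha, ← ig, ← ig, M.comm, ← add_assoc, ← add_assoc,
      add_left_inj, ← map_add, ← map_add] at h
    simpa [act] using hiinj h

/-- The inclusion of N together with the vertexwise sections defines a map from the model W ⊕ V to
L. The formulas for the sections say that this map is linear over Λ^ı for the structure twisted by
c, and the five lemma finishes. -/
lemma exists_cocycle_equivalent {L : ModI k} (E : Extension M.toMod N.toMod L) :
    ∃ c : Cocycle M N, c.extension.Equivalent E := by
  obtain ⟨s₁, s₂, c, sm₁, sm₂, v₁, v₂, p₁, p₂, ha, h1, h2⟩ := exists_cocycle_sections E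
  let i : W₁ × W₂ →+ L.obj := E.incl.hom.hom.toAddMonoidHom.comp N.elt.toAddMonoidHom
  have isc : ∀ (t : k) w, i (t • w) = algebraMap k (ILambda k) t • i w := fun t w => by
    change E.incl.hom.hom (N.elt _) = _
    rw [← algebraMap_smul_elt, map_smul]; rfl
  have ig : ∀ x w, ILambda.gen k x • i w = i (N.act x w) := fun x w => by
    change _ = E.incl.hom.hom (N.elt _)
    rw [← gen_smul_elt, map_smul]; rfl
  have pi : ∀ w, E.proj.hom.hom (i w) = 0 := fun w =>
    congrArg (fun f => f.hom.hom (N.elt w)) E.zero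
  let t₁ : W₁ × V₁ →+ L.obj := AddMonoidHom.coprod (i.comp (AddMonoidHom.inl W₁ W₂)) s₁
  let t₂ : W₂ × V₂ →+ L.obj := AddMonoidHom.coprod (i.comp (AddMonoidHom.inr W₁ W₂)) s₂
  have e₁ : ∀ x, t₁ x = i (x.1, 0) + s₁ x.2 := fun x => rfl
  have e₂ : ∀ x, t₂ x = i (0, x.1) + s₂ x.2 := fun x => rfl
  have hd : c.ext.IsDesc L t₁ t₂ :=
    { smul₁ := fun t x => by
        rw [e₁, e₁, smul_add, ← sm₁, ← isc]; simp
      smul₂ := fun t x => by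
        rw [e₂, e₂, smul_add, ← sm₂, ← isc]; simp
      vert₁ := fun x => by rw [e₁, smul_add, v₁, ig]; simp [act]
      vert₂ := fun x => by rw [e₂, smul_add, v₂, ig]; simp [act]
      arrow := fun x => by
        rw [e₁, e₂, smul_add, ha, ig]
        change _ + (i (0, c.a x.2) + _) = _
        rw [← add_assoc, ← map_add]; simp [act, Cocycle.ext]
      loop₁ := fun x => by
        rw [e₁, e₁, smul_add, h1, ig]
        change _ + (i (c.e₁ x.2, 0) + _) = _
        rw [← add_assoc, ← map_add]; simp [act, Cocycle.ext]
      loop₂ := fun x => by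
        rw [e₂, e₂, smul_add, h2, ig]
        change _ + (i (0, c.e₂ x.2) + _) = _
        rw [← add_assoc, ← map_add]; simp [act, Cocycle.ext] }
  refine ⟨c, Extension.equivalent_of_hom (c.ext.desc hd) (hom_ext fun v => ?_)
    (hom_ext fun v => ?_)⟩
  · change (c.ext.desc hd).hom.hom (c.isHom_incl.map.hom.hom (N.elt v)) = i v
    rw [IsHom.map_elt, desc_elt, e₁, e₂]
    simp [← map_add]
  · change E.proj.hom.hom ((c.ext.desc hd).hom.hom (c.ext.elt v)) =
      c.isHom_proj.map.hom.hom (c.ext.elt v)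
    rw [IsHom.map_elt, desc_elt, e₁, e₂]
    simp only [map_add, pi, p₁, p₂, zero_add, LinearMap.snd_apply]
    simp [← map_add]

/-- The product of the classes of two representations, computed from a system of representatives
of cocycles modulo coboundaries. -/
lemma cls_mul_cls_of_cocycles {Θ : Type*} [Fintype Θ] (c : Θ → Cocycle M N)
    (complete : ∀ c', ∃ θ, (c θ).Cohomologous c')
    (irredundant : ∀ θ θ', (c θ).Cohomologous (c θ') → θ = θ') :
    cls M.toMod * cls N.toMod = (vv k ^ eulerForm (res M.toMod) (res N.toMod) /
      (Nat.card {p : (V₁ →ₗ[k] W₁) × (V₂ →ₗ[k] W₂) // M.IsHom N p.1 p.2} : Coeff k)) •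
      ∑ θ, cls (c θ).ext.toMod := by
  rw [← Nat.card_congr (homEquiv M N)]
  refine cls_mul_cls _ (fun θ => (c θ).extension) (fun L E => ?_) fun θ θ' h =>
    irredundant θ θ' (Cocycle.cohomologous_of_equivalent h)
  obtain ⟨c', hc'⟩ := exists_cocycle_equivalent E
  obtain ⟨θ, hθ⟩ := complete c'
  exact ⟨θ, hθ.equivalent.trans hc'⟩

end IRep

/-! ### The Euler form of kQ in terms of dimension vectors. -/

section EulerCharacteristic

open Abelian

variable {k : Type*} [Field k] {C : Type u} [Category.{v} C] [Abelian C] [Linear k C]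
  [HasExt.{v} C]

/-- The Euler characteristic of `Hom(X₃, Y)` and `Ext¹(X₃, Y)`, computed from a short exact
sequence `0 ⟶ X₁ ⟶ X₂ ⟶ X₃ ⟶ 0` with `X₂` projective. -/
lemma finrank_hom_sub_finrank_ext_one {S : ShortComplex C} (hS : S.ShortExact)
    [Projective S.X₂] (Y : C) [Module.Finite k (S.X₁ ⟶ Y)] [Module.Finite k (S.X₂ ⟶ Y)] :
    (Module.finrank k (S.X₃ ⟶ Y) : ℤ) - Module.finrank k (Ext.{v} S.X₃ Y 1) =
      Module.finrank k (S.X₂ ⟶ Y) - Module.finrank k (S.X₁ ⟶ Y) := by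
  have := hS.mono_f
  have := hS.epi_g
  let φ : (S.X₂ ⟶ Y) →ₗ[k] (S.X₁ ⟶ Y) := Linear.leftComp k Y S.f
  let γ : (S.X₃ ⟶ Y) →ₗ[k] (S.X₂ ⟶ Y) := Linear.leftComp k Y S.g
  let δ : (S.X₁ ⟶ Y) →ₗ[k] Ext.{v} S.X₃ Y 1 :=
    { toFun := fun f => hS.extClass.comp (Ext.mk₀ f) (add_zero 1)
      map_add' := fun f g => by rw [Ext.mk₀_add, Ext.comp_add]
      map_smul' := fun r f => by rw [Ext.mk₀_smul, Ext.comp_smul]; rfl }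
  have hγ : Function.Injective γ := fun f g h => (cancel_epi S.g).1 h
  have h₁ : LinearMap.ker φ = LinearMap.range γ := by
    ext f
    constructor
    · intro hf
      exact ⟨hS.exact.desc f hf, hS.exact.g_desc f hf⟩
    · rintro ⟨g, rfl⟩
      change S.f ≫ S.g ≫ g = 0
      rw [S.zero_assoc, zero_comp]
  have h₂ : LinearMap.ker δ = LinearMap.range φ := by
    ext f
    constructor
    · intro hf
      obtain ⟨x, hx⟩ := Ext.contravariant_sequence_exact₁ hS Y (Ext.mk₀ f) (add_zero 1) hf
      obtain ⟨g, rfl⟩ := Ext.addEquiv₀.symm.surjective x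
      refine ⟨g, Ext.homEquiv₀.symm.injective ?_⟩
      exact (Ext.mk₀_comp_mk₀ S.f g).symm.trans hx
    · rintro ⟨g, rfl⟩
      change hS.extClass.comp (Ext.mk₀ (S.f ≫ g)) (add_zero 1) = 0
      rw [← Ext.mk₀_comp_mk₀, ← Ext.comp_assoc_of_third_deg_zero, hS.extClass_comp, Ext.zero_comp]
  -- The next term of the long exact sequence, Ext¹(X₂, Y), vanishes because X₂ is projective.
  have h₃ : LinearMap.range δ = ⊤ := LinearMap.range_eq_top.2 fun x => by
    obtain ⟨y, hy⟩ := Ext.contravariant_sequence_exact₃ hS Y x (Ext.eq_zero_of_projective _)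
      (add_zero 1)
    obtain ⟨g, rfl⟩ := Ext.addEquiv₀.symm.surjective y
    exact ⟨g, hy⟩
  -- Rank–nullity for φ and for δ; the rank of φ occurs in both and cancels.
  have r₁ := φ.finrank_range_add_finrank_ker
  have r₂ := δ.finrank_range_add_finrank_ker
  rw [h₁, LinearMap.finrank_range_of_inj hγ] at r₁
  rw [h₂, h₃, finrank_top] at r₂
  lia

end EulerCharacteristic

/-- The image in `kQ` of a vertex or an arrow. -/
def PathAlg.gen (k : Type u) [Field k] (x : QGen) : PathAlg k :=
  RingQuot.mkAlgHom k (QRel k) (FreeAlgebra.ι k x)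

/-- A vertex or arrow of `Q`, as a vertex or arrow of the ıquiver. -/
def QGen.toIGen : QGen → IGen
  | .e i => .e i
  | .α => .α

lemma inclQ_gen (k : Type u) [Field k] (x : QGen) :
    inclQ k (PathAlg.gen k x) = ILambda.gen k x.toIGen := by
  cases x <;> simp [inclQ, PathAlg.gen, QGen.toIGen]

lemma PathAlg.gen_rels (k : Type u) [Field k] :
    (∀ i, gen k (.e i) * gen k (.e i) = gen k (.e i)) ∧
    (∀ i j, i ≠ j → gen k (.e i) * gen k (.e j) = 0) ∧
    (gen k .α * gen k (.e .one) = gen k .α) ∧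
    (gen k (.e .two) * gen k .α = gen k .α) := by
  refine ⟨fun i => ?_, fun i j h => ?_, ?_, ?_⟩
  · simpa [gen] using RingQuot.mkAlgHom_rel k (QRel.idem (k := k) i)
  · simpa [gen] using RingQuot.mkAlgHom_rel k (QRel.orth (k := k) i j h)
  · simpa [gen] using RingQuot.mkAlgHom_rel k (QRel.source (k := k))
  · simpa [gen] using RingQuot.mkAlgHom_rel k (QRel.target (k := k))

namespace IRep

variable {k : Type u} [Field k]
variable {V₁ V₂ : Type u} [AddCommGroup V₁] [AddCommGroup V₂] [Module k V₁] [Module k V₂]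
  [Module.Finite k V₁] [Module.Finite k V₂]
variable {W₁ W₂ : Type u} [AddCommGroup W₁] [AddCommGroup W₂] [Module k W₁] [Module k W₂]
  [Module.Finite k W₁] [Module.Finite k W₂]
variable (M : IRep k V₁ V₂) (N : IRep k W₁ W₂)

/-- A vector of a representation, as an element of the restricted module. -/
def resElt : V₁ × V₂ ≃+ res M.toMod := M.elt

@[simp]
lemma gen_smul_resElt (x : QGen) (v : V₁ × V₂) :
    PathAlg.gen k x • M.resElt v = M.resElt (M.act x.toIGen v) := by
  change inclQ k (PathAlg.gen k x) • M.elt v = M.elt _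
  rw [inclQ_gen, gen_smul_elt]

@[simp]
lemma algebraMap_smul_resElt (c : k) (v : V₁ × V₂) :
    algebraMap k (PathAlg k) c • M.resElt v = M.resElt (c • v) := by
  change inclQ k (algebraMap k (PathAlg k) c) • M.elt v = M.elt _
  rw [AlgHom.commutes, algebraMap_smul_elt]

/-- The data of a morphism from the restriction of a representation to an arbitrary module. -/
structure IsResDesc (M : IRep k V₁ V₂) (B : ModuleCat.{u} (PathAlg k)) (s₁ : V₁ →+ B)
    (s₂ : V₂ →+ B) : Prop where
  smul₁ : ∀ (c : k) x, s₁ (c • x) = algebraMap k (PathAlg k) c • s₁ x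
  smul₂ : ∀ (c : k) x, s₂ (c • x) = algebraMap k (PathAlg k) c • s₂ x
  vert₁ : ∀ x, PathAlg.gen k (.e .one) • s₁ x = s₁ x
  vert₂ : ∀ x, PathAlg.gen k (.e .two) • s₂ x = s₂ x
  arrow : ∀ x, PathAlg.gen k .α • s₁ x = s₂ (M.a x)

/-- The additive map underlying a morphism from the restriction of a representation. -/
def resDescAdd {B : ModuleCat.{u} (PathAlg k)} (s₁ : V₁ →+ B) (s₂ : V₂ →+ B) : res M.toMod →+ B :=
  (AddMonoidHom.coprod s₁ s₂).comp M.resElt.symm.toAddMonoidHom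

@[simp]
lemma resDescAdd_resElt {B : ModuleCat.{u} (PathAlg k)} (s₁ : V₁ →+ B) (s₂ : V₂ →+ B)
    (v : V₁ × V₂) : M.resDescAdd s₁ s₂ (M.resElt v) = s₁ v.1 + s₂ v.2 := rfl

variable {M} in
lemma IsResDesc.map_smul {B : ModuleCat.{u} (PathAlg k)} {s₁ : V₁ →+ B} {s₂ : V₂ →+ B}
    (h : M.IsResDesc B s₁ s₂) (y : PathAlg k) (v : res M.toMod) :
    M.resDescAdd s₁ s₂ (y • v) = y • M.resDescAdd s₁ s₂ v := by
  refine map_smul_of_generators (k := k) (r := QRel k) (M.resDescAdd s₁ s₂) (fun c v => ?_)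
    (fun x v => ?_) y v
  · obtain ⟨v, rfl⟩ := M.resElt.surjective v
    rw [algebraMap_smul_resElt, resDescAdd_resElt, resDescAdd_resElt, Prod.smul_fst,
      Prod.smul_snd, h.smul₁, h.smul₂, smul_add]
  · obtain ⟨v, rfl⟩ := M.resElt.surjective v
    change M.resDescAdd s₁ s₂ (PathAlg.gen k x • M.resElt v) = PathAlg.gen k x • _
    rw [gen_smul_resElt, resDescAdd_resElt, resDescAdd_resElt]
    obtain ⟨idem, orth, src, tgt⟩ := PathAlg.gen_rels k
    have h₁ : ∀ x z, z * PathAlg.gen k (.e .one) = 0 → z • s₁ x = 0 := fun x z hz => by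
      rw [← h.vert₁, ← mul_smul, hz, zero_smul]
    have h₂ : ∀ x z, z * PathAlg.gen k (.e .two) = 0 → z • s₂ x = 0 := fun x z hz => by
      rw [← h.vert₂, ← mul_smul, hz, zero_smul]
    have o12 := orth .one .two (by simp)
    have o21 := orth .two .one (by simp)
    rcases x with (_ | _) | _
    · rw [smul_add, h.vert₁, h₂ _ _ o12]; simp [act, QGen.toIGen]
    · rw [smul_add, h.vert₂, h₁ _ _ o21]; simp [act, QGen.toIGen]
    · rw [smul_add, h.arrow, h₂ _ _ (by rw [← src, mul_assoc, o12, mul_zero])]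
      simp [act, QGen.toIGen]

/-- A morphism from the restriction of a representation to an arbitrary module. -/
def resDesc {B : ModuleCat.{u} (PathAlg k)} {s₁ : V₁ →+ B} {s₂ : V₂ →+ B}
    (h : M.IsResDesc B s₁ s₂) : res M.toMod ⟶ B :=
  ModuleCat.ofHom (X := res M.toMod) (Y := B) { M.resDescAdd s₁ s₂ with map_smul' := h.map_smul }

lemma resDesc_resElt {B : ModuleCat.{u} (PathAlg k)} {s₁ : V₁ →+ B} {s₂ : V₂ →+ B}
    (h : M.IsResDesc B s₁ s₂) (v : V₁ × V₂) : (M.resDesc h).hom (M.resElt v) = s₁ v.1 + s₂ v.2 :=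
  rfl

lemma res_hom_ext {M : IRep k V₁ V₂} {B : ModuleCat.{u} (PathAlg k)} {f g : res M.toMod ⟶ B}
    (h : ∀ v, f.hom (M.resElt v) = g.hom (M.resElt v)) : f = g := by
  ext v; exact h v

lemma isResDesc_of_comm {M : IRep k V₁ V₂} {N : IRep k W₁ W₂} {f₁ : V₁ →ₗ[k] W₁}
    {f₂ : V₂ →ₗ[k] W₂} (h : ∀ x, N.a (f₁ x) = f₂ (M.a x)) :
    M.IsResDesc (res N.toMod)
      (N.resElt.toAddMonoidHom.comp (LinearMap.inl k W₁ W₂ ∘ₗ f₁).toAddMonoidHom)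
      (N.resElt.toAddMonoidHom.comp (LinearMap.inr k W₁ W₂ ∘ₗ f₂).toAddMonoidHom) where
  smul₁ c x := by
    refine Eq.trans ?_ (N.algebraMap_smul_resElt c (f₁ x, 0)).symm
    simp
  smul₂ c x := by
    refine Eq.trans ?_ (N.algebraMap_smul_resElt c (0, f₂ x)).symm
    simp
  vert₁ x := (N.gen_smul_resElt _ (f₁ x, 0)).trans (by simp [act, QGen.toIGen])
  vert₂ x := (N.gen_smul_resElt _ (0, f₂ x)).trans (by simp [act, QGen.toIGen])
  arrow x := (N.gen_smul_resElt _ (f₁ x, 0)).trans (by simp [act, QGen.toIGen, h])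

/-- The morphism of `kQ`-modules given by linear maps commuting with the arrow. -/
def resMap {M : IRep k V₁ V₂} {N : IRep k W₁ W₂} {f₁ : V₁ →ₗ[k] W₁}
    {f₂ : V₂ →ₗ[k] W₂} (h : ∀ x, N.a (f₁ x) = f₂ (M.a x)) : res M.toMod ⟶ res N.toMod :=
  M.resDesc (isResDesc_of_comm h)

lemma resMap_resElt {M : IRep k V₁ V₂} {N : IRep k W₁ W₂} {f₁ : V₁ →ₗ[k] W₁}
    {f₂ : V₂ →ₗ[k] W₂} (h : ∀ x, N.a (f₁ x) = f₂ (M.a x)) (v : V₁ × V₂) :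
    (resMap h).hom (M.resElt v) = N.resElt (f₁ v.1, f₂ v.2) := by
  rw [resMap, resDesc_resElt]
  change N.resElt (f₁ v.1, 0) + N.resElt (0, f₂ v.2) = _
  rw [← map_add]
  simp

/-- The obstruction for a pair of linear maps to commute with the arrow. -/
def commDefect : (V₁ →ₗ[k] W₁) × (V₂ →ₗ[k] W₂) →ₗ[k] V₁ →ₗ[k] W₂ where
  toFun p := N.a ∘ₗ p.1 - p.2 ∘ₗ M.a
  map_add' p q := by ext x; simp; abel
  map_smul' c p := by ext x; simp [smul_sub]

lemma commDefect_apply (p : (V₁ →ₗ[k] W₁) × (V₂ →ₗ[k] W₂)) (x : V₁) :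
    M.commDefect N p x = N.a (p.1 x) - p.2 (M.a x) := rfl

/-- Morphisms between restrictions are pairs of linear maps commuting with the arrow. -/
def resHomEquiv : LinearMap.ker (M.commDefect N) ≃ₗ[k] (res M.toMod ⟶ res N.toMod) :=
  have h : ∀ p : LinearMap.ker (M.commDefect N), ∀ x, N.a (p.1.1 x) = p.1.2 (M.a x) := fun p x =>
    sub_eq_zero.1 (LinearMap.congr_fun (LinearMap.mem_ker.1 p.2) x)
  LinearEquiv.ofBijective
    { toFun := fun p => resMap (h p)
      map_add' := fun p q => res_hom_ext fun v => by
        change _ = (resMap (h p)).hom (M.resElt v) + (resMap (h q)).hom (M.resElt v)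
        simp only [resMap_resElt, ← map_add]
        rfl
      map_smul' := fun c p => res_hom_ext fun v => by
        change _ = algebraMap k (PathAlg k) c • (resMap (h p)).hom (M.resElt v)
        simp only [resMap_resElt, algebraMap_smul_resElt]
        rfl }
    ⟨fun p q hpq => by
      have key : ∀ v : V₁ × V₂, ((p.1.1 v.1, p.1.2 v.2) : W₁ × W₂) = (q.1.1 v.1, q.1.2 v.2) :=
        fun v => N.resElt.injective (by
          rw [← resMap_resElt (h p), ← resMap_resElt (h q)]
          exact congrArg (fun f => f.hom (M.resElt v)) hpq)
      exact Subtype.ext (Prod.ext (LinearMap.ext fun x => congrArg Prod.fst (key (x, 0)))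
        (LinearMap.ext fun x => congrArg Prod.snd (key (0, x)))), fun f => by
      let F : V₁ × V₂ →ₗ[k] W₁ × W₂ :=
        { toFun := fun v => N.resElt.symm (f.hom (M.resElt v))
          map_add' := fun v w => by rw [map_add, map_add, map_add]
          map_smul' := fun c v => N.resElt.injective (by
            rw [AddEquiv.apply_symm_apply, RingHom.id_apply, ← algebraMap_smul_resElt,
              ← algebraMap_smul_resElt, AddEquiv.apply_symm_apply, map_smul]) }
      have hF' : ∀ v, N.resElt (F v) = f.hom (M.resElt v) := fun v => N.resElt.apply_symm_apply _
      have hF : ∀ x v, F (M.act (QGen.toIGen x) v) = N.act (QGen.toIGen x) (F v) := fun x v =>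
        N.resElt.injective (by
          rw [hF', ← gen_smul_resElt, ← gen_smul_resElt, hF', map_smul])
      have h1 : ∀ x, F (x, 0) = ((F (x, 0)).1, 0) := fun x => by
        simpa [act, QGen.toIGen] using hF (.e .one) (x, 0)
      have h2 : ∀ x, F (0, x) = (0, (F (0, x)).2) := fun x => by
        simpa [act, QGen.toIGen] using hF (.e .two) (0, x)
      have hc : (LinearMap.fst k _ _ ∘ₗ F ∘ₗ LinearMap.inl k _ _,
          LinearMap.snd k _ _ ∘ₗ F ∘ₗ LinearMap.inr k _ _) ∈ LinearMap.ker (M.commDefect N) :=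
        LinearMap.mem_ker.2 (LinearMap.ext fun x => sub_eq_zero.2 (by
          simpa [act, QGen.toIGen] using (congrArg Prod.snd (hF .α (x, 0))).symm))
      refine ⟨⟨_, hc⟩, res_hom_ext fun v => ?_⟩
      · refine (resMap_resElt (h ⟨_, hc⟩) v).trans ((hF' v).symm.trans (congrArg _ ?_)).symm
        change F v = ((F (v.1, 0)).1, (F (0, v.2)).2)
        have : F v = F (v.1, 0) + F (0, v.2) := by rw [← map_add]; simp
        rw [this, h1, h2]; simp⟩

instance : Module.Finite k (res M.toMod ⟶ res N.toMod) := Module.Finite.equiv (M.resHomEquiv N)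

/-- With an injective arrow there is no obstruction: given a retraction r of the arrow, the pair (0,
-f ∘ r) has defect f. Hence `commDefect` is onto and its kernel has the expected dimension. -/
lemma finrank_res_hom_of_injective (h : Function.Injective M.a) :
    (Module.finrank k (res M.toMod ⟶ res N.toMod) : ℤ) =
      Module.finrank k V₁ * Module.finrank k W₁ + Module.finrank k V₂ * Module.finrank k W₂ -
        Module.finrank k V₁ * Module.finrank k W₂ := by
  obtain ⟨r, hr⟩ := M.a.exists_leftInverse_of_injective (LinearMap.ker_eq_bot.2 h)
  have hsurj : LinearMap.range (M.commDefect N) = ⊤ := LinearMap.range_eq_top.2 fun f =>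
    ⟨(0, -(f ∘ₗ r)), LinearMap.ext fun x => by
      have : r (M.a x) = x := LinearMap.congr_fun hr x
      simp [commDefect_apply, this]⟩
  have := (M.commDefect N).finrank_range_add_finrank_ker
  rw [hsurj, finrank_top, Module.finrank_prod, Module.finrank_linearMap, Module.finrank_linearMap,
    Module.finrank_linearMap] at this
  rw [← (M.resHomEquiv N).finrank_eq]
  rw [← Nat.cast_mul, ← Nat.cast_mul, ← Nat.cast_mul]
  lia

/-- An injective arrow splits V₂ as a(V₁) plus a complement, so the representation is a sum of
copies of the projectives at the vertices 1 and 2. A lift may thus be chosen freely on V₁ and on the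
complement, and α prescribes it on a(V₁). -/
lemma projective_res_of_injective (h : Function.Injective M.a) : Projective (res M.toMod) := by
  obtain ⟨r, hr⟩ := M.a.exists_leftInverse_of_injective (LinearMap.ker_eq_bot.2 h)
  have hr : ∀ x, r (M.a x) = x := fun x => LinearMap.congr_fun hr x
  obtain ⟨idem, orth, src, tgt⟩ := PathAlg.gen_rels k
  refine ⟨fun {E B} f g hg => ?_⟩
  have hsurj : Function.Surjective g.hom := (ModuleCat.epi_iff_surjective g).1 hg
  let _ : Module k E := Module.compHom E (algebraMap k (PathAlg k))
  let _ : Module k B := Module.compHom B (algebraMap k (PathAlg k))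
  let gk : E →ₗ[k] B :=
    { g.hom.toAddMonoidHom with map_smul' := fun c x => map_smul g.hom (algebraMap k _ c) x }
  obtain ⟨σ, hσ⟩ := gk.exists_rightInverse_of_surjective (LinearMap.range_eq_top.2 hsurj)
  have hσ : ∀ b, g.hom (σ b) = b := fun b => LinearMap.congr_fun hσ b
  let act : QGen → E →ₗ[k] E := fun x =>
    { toFun := fun l => PathAlg.gen k x • l
      map_add' := fun l l' => smul_add _ _ _
      map_smul' := fun t l => by
        change PathAlg.gen k x • algebraMap k (PathAlg k) t • l =
          algebraMap k (PathAlg k) t • PathAlg.gen k x • l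
        rw [← mul_smul, ← mul_smul, Algebra.commutes] }
  have gg : ∀ x y l, act x (act y l) = (PathAlg.gen k x * PathAlg.gen k y) • l := fun x y l =>
    (mul_smul _ _ _).symm
  have hact : ∀ x l, g.hom (act x l) = PathAlg.gen k x • g.hom l := fun x l => map_smul g.hom _ _
  let fk : V₁ × V₂ →ₗ[k] B :=
    { toFun := fun v => f.hom (M.resElt v)
      map_add' := fun v w => by rw [map_add, map_add]
      map_smul' := fun c v => by rw [← algebraMap_smul_resElt, map_smul]; rfl }
  have hfk : ∀ x v, PathAlg.gen k x • fk v = fk (M.act x.toIGen v) := fun x v => by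
    change _ • f.hom (M.resElt _) = f.hom (M.resElt (M.act x.toIGen v))
    rw [← gen_smul_resElt, map_smul]
  let s₁ : V₁ →ₗ[k] E := act (.e .one) ∘ₗ σ ∘ₗ fk ∘ₗ LinearMap.inl k V₁ V₂
  -- The first summand is the value forced on a(V₁); the second is a free lift on the complement,
  -- onto which 1 - a ∘ r projects.
  let s₂ : V₂ →ₗ[k] E := act .α ∘ₗ s₁ ∘ₗ r +
    act (.e .two) ∘ₗ σ ∘ₗ fk ∘ₗ LinearMap.inr k V₁ V₂ ∘ₗ (LinearMap.id - M.a ∘ₗ r)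
  have gs₁ : ∀ x, g.hom (s₁ x) = fk (x, 0) := fun x => by
    change g.hom (act _ (σ (fk (x, 0)))) = _
    rw [hact, hσ, hfk]
    simp [IRep.act, QGen.toIGen]
  have gs₂ : ∀ x, g.hom (s₂ x) = fk (0, x) := fun x => by
    change g.hom (act _ (s₁ (r x)) + act _ (σ (fk (0, x - M.a (r x))))) = _
    rw [map_add, hact, hact, hσ, gs₁, hfk, hfk, ← map_add]
    simp [IRep.act, QGen.toIGen]
  have hd : M.IsResDesc E s₁.toAddMonoidHom s₂.toAddMonoidHom :=
    { smul₁ := s₁.map_smul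
      smul₂ := s₂.map_smul
      vert₁ := fun x => by
        change act (.e .one) (act (.e .one) _) = act (.e .one) _
        rw [gg, idem]; rfl
      vert₂ := fun x => by
        change act (.e .two) (act .α _ + act (.e .two) _) = act .α _ + act (.e .two) _
        rw [map_add, gg, gg, idem, tgt]; rfl
      arrow := fun x => by
        change _ = act .α (s₁ (r (M.a x))) + act (.e .two) (σ (fk (0, M.a x - M.a (r (M.a x)))))
        rw [hr, sub_self]
        have : fk ((0 : V₁), (0 : V₂)) = 0 := map_zero fk
        rw [this, map_zero, map_zero, add_zero]; rfl }
  refine ⟨M.resDesc hd, res_hom_ext fun v => ?_⟩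
  change g.hom ((M.resDesc hd).hom (M.resElt v)) = fk v
  rw [resDesc_resElt, map_add]
  change g.hom (s₁ v.1) + g.hom (s₂ v.2) = _
  rw [gs₁, gs₂, ← map_add]
  simp

/-- The Euler form of restrictions of representations in terms of dimension vectors. -/
lemma eulerForm_res : eulerForm (res M.toMod) (res N.toMod) =
    Module.finrank k V₁ * Module.finrank k W₁ + Module.finrank k V₂ * Module.finrank k W₂ -
      Module.finrank k V₁ * Module.finrank k W₂ := by
  -- The standard resolution 0 ⟶ K ⟶ P ⟶ M ⟶ 0, where P is P₁ ⊗ V₁ ⊕ P₂ ⊗ V₂ and K is P₂ ⊗ V₁, with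
  -- P_i the projective of kQ at i. At the vertex 2 it reads x ↦ (x, -a x) and (x, y) ↦ a x + y. The
  -- loops are invisible to kQ, so they are set to zero in P and K.
  let P : IRep k V₁ (V₁ × V₂) :=
    ⟨LinearMap.inl k V₁ V₂, 0, 0, fun _ => rfl, fun _ => rfl, fun _ => by simp; rfl⟩
  let K : IRep k PUnit.{u + 1} V₁ := ⟨0, 0, 0, fun _ => rfl, fun _ => rfl, fun _ => rfl⟩
  have hP : Function.Injective P.a := LinearMap.inl_injective
  have hK : Function.Injective K.a := Function.injective_of_subsingleton _
  let i₂ : V₁ →ₗ[k] V₁ × V₂ := LinearMap.prod LinearMap.id (-M.a)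
  let p₂ : V₁ × V₂ →ₗ[k] V₂ := LinearMap.coprod M.a LinearMap.id
  have hi : ∀ x, P.a ((0 : PUnit.{u + 1} →ₗ[k] V₁) x) = i₂ (K.a x) := fun x => by simp [K]
  have hp : ∀ x, M.a ((LinearMap.id : V₁ →ₗ[k] V₁) x) = p₂ (P.a x) := fun x => by simp [p₂, P]
  have zero : resMap hi ≫ resMap hp = 0 := res_hom_ext fun v => by
    change (resMap hp).hom ((resMap hi).hom (K.resElt v)) = M.resElt (0, 0)
    rw [resMap_resElt, resMap_resElt]
    simp [i₂, p₂]
  have hS : (ShortComplex.mk (resMap hi) (resMap hp) zero).ShortExact := by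
    refine ModuleCat.shortComplex_shortExact _ (fun v => ⟨fun hv => ?_, ?_⟩) (fun v w hvw => ?_)
      (fun w => ?_)
    · obtain ⟨v, rfl⟩ := P.resElt.surjective v
      have hv := M.resElt.injective ((resMap_resElt hp v).symm.trans
        (hv.trans (map_zero M.resElt).symm))
      have h₁ : v.1 = 0 := congrArg Prod.fst hv
      have h₂ : M.a v.2.1 + v.2.2 = 0 := congrArg Prod.snd hv
      refine ⟨K.resElt (0, v.2.1), (resMap_resElt hi _).trans (congrArg _ (Prod.ext h₁.symm
        (Prod.ext rfl ?_)))⟩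
      exact (eq_neg_of_add_eq_zero_right h₂).symm
    · rintro ⟨w, rfl⟩
      exact congrArg (fun f => f.hom w) zero
    · obtain ⟨v, rfl⟩ := K.resElt.surjective v
      obtain ⟨w, rfl⟩ := K.resElt.surjective w
      have h := P.resElt.injective
        ((resMap_resElt hi v).symm.trans (hvw.trans (resMap_resElt hi w)))
      exact congrArg K.resElt (Prod.ext rfl (congrArg (fun x => x.2.1) h))
    · obtain ⟨w, rfl⟩ := M.resElt.surjective w
      exact ⟨P.resElt (w.1, 0, w.2), (resMap_resElt hp _).trans (by simp [p₂])⟩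
  have := P.projective_res_of_injective hP
  refine (finrank_hom_sub_finrank_ext_one (k := k) hS (res N.toMod)).trans ?_
  rw [P.finrank_res_hom_of_injective N hP, K.finrank_res_hom_of_injective N hK]
  simp only [Module.finrank_prod, Module.finrank_zero_of_subsingleton]
  push_cast
  ring

end IRep

/-! ### The small modules involved, and the identifications forced by the singularity category. -/

lemma ModI.surjective_of_epi {k : Type u} [Field k] {A B : ModI k} (g : A ⟶ B) [Epi g] :
    Function.Surjective g.hom.hom :=
  (ModuleCat.epi_iff_surjective _).1
    (inferInstanceAs (Epi ((forget₂ (ModI k) (ModuleCat.{u} (ILambda k))).map g)))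

lemma ModI.isoClass_eq_of_bijective {k : Type u} [Field k] {A B : ModI k} (f : A ⟶ B)
    (h : Function.Bijective f.hom.hom) : isoClass A = isoClass B :=
  isoClass_eq_iff.2 ⟨(ModuleCat.isFG (ILambda k)).fullyFaithfulι.preimageIso
    (LinearEquiv.ofBijective f.hom.hom h).toModuleIso⟩

namespace IRep

variable (k : Type u) [Field k]

/-- The nilpotent Jordan block of size two. -/
def jordan : k × k →ₗ[k] k × k := LinearMap.inl k k k ∘ₗ LinearMap.snd k k k

@[simp]
lemma jordan_apply (x : k × k) : jordan k x = (x.2, 0) := rfl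

/-- The simple representation at the vertex `1`. -/
def simpleOne : IRep k k PUnit.{u + 1} := ⟨0, 0, 0, fun _ => rfl, fun _ => rfl, fun _ => rfl⟩

/-- The simple representation at the vertex `2`. -/
def simpleTwo : IRep k PUnit.{u + 1} k := ⟨0, 0, 0, fun _ => rfl, fun _ => rfl, fun _ => rfl⟩

/-- The generalized simple representation at the vertex `1`. -/
def genSimpleOne : IRep k (k × k) PUnit.{u + 1} :=
  ⟨0, jordan k, 0, fun _ => rfl, fun _ => rfl, fun _ => rfl⟩

/-- The generalized simple representation at the vertex `2`. -/
def genSimpleTwo : IRep k PUnit.{u + 1} (k × k) :=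
  ⟨0, 0, jordan k, fun _ => rfl, fun _ => rfl, fun _ => rfl⟩

/-- The projective representation generated at the vertex `1`. -/
def projOne : IRep k (k × k) (k × k) :=
  ⟨LinearMap.id, jordan k, jordan k, fun _ => rfl, fun _ => rfl, fun _ => rfl⟩

variable {k}

/-- The representation of dimension vector `(1, 1)` with arrow `b`. -/
def dim11 (b : k) : IRep k k k :=
  ⟨b • LinearMap.id, 0, 0, fun _ => rfl, fun _ => rfl, fun _ => by simp⟩

/-- The representation of dimension vector `(2, 1)` with loop `a` times a Jordan block, and arrow
`b` times the second projection. -/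
def dim21 (a b : k) : IRep k (k × k) k :=
  ⟨b • LinearMap.snd k k k, a • jordan k, 0, fun _ => by simp, fun _ => rfl, fun _ => by simp⟩

/-- The representation of dimension vector `(1, 2)` with loop `a` times a Jordan block, and arrow
`b` times the first inclusion. -/
def dim12 (a b : k) : IRep k k (k × k) :=
  ⟨b • LinearMap.inl k k k, 0, a • jordan k, fun _ => rfl, fun _ => by simp, fun _ => by simp⟩

section

variable {V₁ V₂ : Type u} [AddCommGroup V₁] [AddCommGroup V₂] [Module k V₁] [Module k V₂]
  [Module.Finite k V₁] [Module.Finite k V₂]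

/-- The part of a representation at the vertex `2` is a subrepresentation, with quotient the part
at the vertex `1`. -/
lemma nonempty_vertex_extension (L : IRep k V₁ V₂) (M : IRep k V₁ PUnit.{u + 1})
    (N : IRep k PUnit.{u + 1} V₂) (hM : M.e₁ = L.e₁) (hN : N.e₂ = L.e₂) :
    Nonempty (Extension M.toMod N.toMod L.toMod) := by
  have hi : N.IsHom L (0 : PUnit.{u + 1} →ₗ[k] V₁) (LinearMap.id : V₂ →ₗ[k] V₂) :=
    ⟨fun x => by
      rw [LinearMap.zero_apply, map_zero, Subsingleton.elim x 0, map_zero, map_zero],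
      fun x => by simp, fun x => by simp [hN]⟩
  have hp : L.IsHom M (LinearMap.id : V₁ →ₗ[k] V₁) (0 : V₂ →ₗ[k] PUnit.{u + 1}) :=
    ⟨fun x => rfl, fun x => by simp [hM], fun x => rfl⟩
  obtain ⟨zero, h⟩ := shortExact_of_isHom hi hp (Function.injective_of_subsingleton _)
    Function.injective_id (fun x => ⟨fun hx => ⟨0, hx.symm⟩, fun ⟨_, hx⟩ => hx.symm⟩)
    (fun x => ⟨fun _ => ⟨x, rfl⟩, fun _ => rfl⟩) Function.surjective_id
    (fun x => ⟨0, rfl⟩)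
  exact ⟨⟨_, _, zero, h⟩⟩

end

/-- Scalar multiples of two elements, as an additive map. -/
def comb {L : ModI k} (l l' : L.obj) : k × k →+ L.obj where
  toFun x := algebraMap k (ILambda k) x.2 • l + algebraMap k (ILambda k) x.1 • l'
  map_zero' := by simp
  map_add' x y := by simp only [Prod.fst_add, Prod.snd_add, map_add, add_smul]; abel

lemma comb_apply {L : ModI k} (l l' : L.obj) (x : k × k) :
    comb l l' x = algebraMap k (ILambda k) x.2 • l + algebraMap k (ILambda k) x.1 • l' := rfl

lemma smul_comb {L : ModI k} (l l' : L.obj) (x : k × k) (y : ILambda k) :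
    y • comb l l' x = comb (y • l) (y • l') x := by
  simp only [comb_apply, smul_add, ← mul_smul, Algebra.commutes]

lemma comb_smul {L : ModI k} (l l' : L.obj) (c : k) (x : k × k) :
    comb l l' (c • x) = algebraMap k (ILambda k) c • comb l l' x := by
  simp only [comb_apply, smul_add, ← mul_smul, ← map_mul]; rfl

/-- This is the universal property of Λe₂: the vertex 2 is a sink, so Λe₂ has basis ε₂, e₂, and any
l determines a morphism with e₂ ↦ e₂l. In `k × k` the second coordinate belongs to the generator,
the first to its image under the loop. -/
lemma isDesc_genSimpleTwo {L : ModI k} (l : L.obj) :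
    (genSimpleTwo k).IsDesc L 0
      (comb (ILambda.gen k (.e .two) • l) (ILambda.gen k (.ε .two) • l)) := by
  obtain ⟨-, idem, orth, src, tgt, lsrc, ltgt, nil, com⟩ := gen_rels (k := k)
  refine ⟨fun c x => by simp, comb_smul _ _, fun x => by simp, fun x => ?_, fun x => ?_,
    fun x => by simp, fun x => ?_⟩
  · rw [smul_comb, ← mul_smul, ← mul_smul, idem, ltgt]
  · simp [genSimpleTwo]
  · rw [smul_comb, ← mul_smul, ← mul_smul, nil, lsrc]
    simp [comb_apply, genSimpleTwo]

instance projective_genSimpleTwo : Projective (genSimpleTwo k).toMod := by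
  refine ⟨fun {E B} f g _ => ?_⟩
  -- The vector (0, (0, 1)) generates the module, so lifting its image suffices.
  obtain ⟨l, hl⟩ := ModI.surjective_of_epi g (f.hom.hom ((genSimpleTwo k).elt (0, (0, 1))))
  refine ⟨(genSimpleTwo k).desc (isDesc_genSimpleTwo l), hom_ext fun v => ?_⟩
  change g.hom.hom (((genSimpleTwo k).desc _).hom.hom ((genSimpleTwo k).elt v)) = _
  rw [desc_elt, AddMonoidHom.zero_apply, zero_add, comb_apply]
  simp only [map_add, map_smul, hl]
  simp only [← map_smul, ← map_add, gen_smul_elt, algebraMap_smul_elt]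
  congr 2
  refine Prod.ext (Subsingleton.elim _ _) ?_
  simp [act, genSimpleTwo]

/-- Likewise for Λe₁, with basis ε₁, e₁ at the vertex 1 and αε₁, α at the vertex 2. -/
lemma isDesc_projOne {L : ModI k} (l : L.obj) :
    (projOne k).IsDesc L (comb (ILambda.gen k (.e .one) • l) (ILambda.gen k (.ε .one) • l))
      (comb (ILambda.gen k .α • l) ((ILambda.gen k .α * ILambda.gen k (.ε .one)) • l)) := by
  obtain ⟨-, idem, orth, src, tgt, lsrc, ltgt, nil, com⟩ := gen_rels (k := k)
  refine ⟨comb_smul _ _, comb_smul _ _, fun x => ?_, fun x => ?_, fun x => ?_, fun x => ?_,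
    fun x => ?_⟩
  · rw [smul_comb, ← mul_smul, ← mul_smul, idem, ltgt]
  · rw [smul_comb, ← mul_smul, ← mul_smul, ← mul_assoc, tgt]
  · rw [smul_comb, ← mul_smul, ← mul_smul, src]; rfl
  · rw [smul_comb, ← mul_smul, ← mul_smul, nil, lsrc]
    simp [comb_apply, projOne]
  · rw [smul_comb, ← mul_smul, ← mul_smul, ← mul_assoc, com, mul_assoc, nil]
    simp [comb_apply, projOne]

instance projective_projOne : Projective (projOne k).toMod := by
  refine ⟨fun {E B} f g _ => ?_⟩
  obtain ⟨l, hl⟩ := ModI.surjective_of_epi g (f.hom.hom ((projOne k).elt ((0, 1), 0)))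
  refine ⟨(projOne k).desc (isDesc_projOne l), hom_ext fun v => ?_⟩
  change g.hom.hom (((projOne k).desc _).hom.hom ((projOne k).elt v)) = _
  rw [desc_elt, comb_apply, comb_apply]
  simp only [map_add, map_smul, hl]
  simp only [← map_smul, ← map_add, mul_smul, gen_smul_elt, algebraMap_smul_elt]
  congr 2
  simp [act, projOne]

/-- The part of Λe₁ at the vertex 2 is 𝔼₂, which gives the projective resolution 0 ⟶ 𝔼₂ ⟶ Λe₁ ⟶ 𝔼₁ ⟶
0. -/
lemma hasProjectiveDimensionLE_genSimpleOne :
    HasProjectiveDimensionLE (genSimpleOne k).toMod 1 := by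
  obtain ⟨E⟩ := nonempty_vertex_extension (projOne k) (genSimpleOne k) (genSimpleTwo k) rfl rfl
  exact E.shortExact.hasProjectiveDimensionLT_X₃ 1
    (inferInstanceAs (HasProjectiveDimensionLT (genSimpleTwo k).toMod 1))
    (inferInstanceAs (HasProjectiveDimensionLT (projOne k).toMod (1 + 1)))

/-- With a nonzero loop the vertex 1 part is 𝔼₁, so for every b the module is an extension of 𝔼₁ by
S₂. Since 𝔼₁ has finite projective dimension, the singularity category sees only S₂ and forgets the
arrow b. This is where the ıHall algebra departs from the Hall algebra. -/
lemma cls_dim21_one (b : k) : cls (dim21 1 b).toMod = cls (dim21 1 0).toMod := by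
  obtain ⟨E⟩ := nonempty_vertex_extension (dim21 1 b) (genSimpleOne k) (simpleTwo k)
    (by simp [dim21, genSimpleOne]) rfl
  obtain ⟨E'⟩ := nonempty_vertex_extension (dim21 1 0) (genSimpleOne k) (simpleTwo k)
    (by simp [dim21, genSimpleOne]) rfl
  exact cls_eq_of_extensions E E'
    (singularIso_of_extensions E E' 1 hasProjectiveDimensionLE_genSimpleOne)

/-- Dually, for every b the module is an extension of S₁ by the projective 𝔼₂, and only S₁ survives
in the singularity category. -/
lemma cls_dim12_one (b : k) : cls (dim12 1 b).toMod = cls (dim12 1 0).toMod := by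
  obtain ⟨E⟩ := nonempty_vertex_extension (dim12 1 b) (simpleOne k) (genSimpleTwo k) rfl
    (by simp [dim12, genSimpleTwo])
  obtain ⟨E'⟩ := nonempty_vertex_extension (dim12 1 0) (simpleOne k) (genSimpleTwo k) rfl
    (by simp [dim12, genSimpleTwo])
  exact cls_eq_of_extensions E E' (singularIso_of_extensions' E E' 0
    (inferInstanceAs (HasProjectiveDimensionLT (genSimpleTwo k).toMod 1)))

/-! ### Rescaling -/

lemma isoClass_dim11 {b : k} (hb : b ≠ 0) :
    isoClass (dim11 b).toMod = isoClass (dim11 (1 : k)).toMod :=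
  isoClass_eq (LinearEquiv.smulOfNeZero k k b hb) (LinearEquiv.refl k k)
    ⟨fun x => by simp [dim11], fun x => by simp [dim11], fun x => by simp [dim11]⟩

/-- The base changes diag(s, 1) at the vertex 1 and t at the vertex 2 rescale loop and arrow
independently. Hence only the vanishing of each parameter matters, and sums over k × k reduce to
four classes. -/
lemma isoClass_dim21 (a b : k) {s t : k} (hs : s ≠ 0) (ht : t ≠ 0) :
    isoClass (dim21 a b).toMod = isoClass (dim21 (s * a) (t * b)).toMod :=
  isoClass_eq ((LinearEquiv.smulOfNeZero k k s hs).prodCongr (LinearEquiv.refl k k))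
    (LinearEquiv.smulOfNeZero k k t ht)
    ⟨fun x => by simp [dim21, mul_assoc], fun x => by simp [dim21, mul_assoc],
      fun x => by simp [dim21]⟩

lemma isoClass_dim12 (a b : k) {s t : k} (hs : s ≠ 0) (ht : t ≠ 0) :
    isoClass (dim12 (s * a) (t * b)).toMod = isoClass (dim12 a b).toMod :=
  isoClass_eq (LinearEquiv.smulOfNeZero k k t ht)
    ((LinearEquiv.refl k k).prodCongr (LinearEquiv.smulOfNeZero k k s hs))
    ⟨fun x => by simp [dim12]; ring, fun x => by simp [dim12],
      fun x => by simp [dim12]; ring⟩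

/-! ### The standard modules as representations -/

lemma isoClass_eq_of_isDesc {V₁ V₂ : Type u} [AddCommGroup V₁] [AddCommGroup V₂] [Module k V₁]
    [Module k V₂] [Module.Finite k V₁] [Module.Finite k V₂] {M : IRep k V₁ V₂} {L : ModI k}
    {s₁ : V₁ →+ L.obj} {s₂ : V₂ →+ L.obj} (h : M.IsDesc L s₁ s₂)
    (hb : Function.Bijective fun v : V₁ × V₂ => s₁ v.1 + s₂ v.2) :
    isoClass M.toMod = isoClass L :=
  ModI.isoClass_eq_of_bijective (M.desc h) hb

/-- An element of an algebra, as an element of the module `pullback φ`. -/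
def pullbackElt {B : Type u} [Ring B] [Algebra k B] [Module.Finite k B] (φ : ILambda k →ₐ[k] B) :
    B ≃+ (pullback φ).obj := AddEquiv.refl B

lemma smul_pullbackElt {B : Type u} [Ring B] [Algebra k B] [Module.Finite k B]
    (φ : ILambda k →ₐ[k] B) (y : ILambda k) (b : B) :
    y • pullbackElt φ b = pullbackElt φ (φ y * b) := rfl

lemma simpleHom_gen (i : Vertex) (x : IGen) : simpleHom k i (ILambda.gen k x) =
    match x with | .e j => if j = i then 1 else 0 | .α => 0 | .ε _ => 0 := by
  cases x <;> simp [simpleHom, ILambda.gen]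

lemma genSimpleHom_gen (i : Vertex) (x : IGen) : genSimpleHom k i (ILambda.gen k x) =
    match x with
      | .e j => if j = i then 1 else 0
      | .α => 0
      | .ε j => if j = i then DualNumber.eps else 0 := by
  cases x <;> simp [genSimpleHom, ILambda.gen]

lemma isoClass_simpleOne : isoClass (simpleOne k).toMod = isoClass (simpleModule k .one) := by
  have h : (simpleOne k).IsDesc (pullback (simpleHom k .one))
      (pullbackElt (simpleHom k .one)).toAddMonoidHom 0 := by
    constructor <;> intros <;>
      simp [smul_pullbackElt, simpleHom_gen, simpleOne, Algebra.smul_def]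
  refine isoClass_eq_of_isDesc h ?_
  have hb : Function.Bijective fun v : k × PUnit.{u + 1} =>
      pullbackElt (simpleHom k .one) v.1 :=
    (pullbackElt _).bijective.comp (Equiv.prodPUnit k).bijective
  exact (congrArg Function.Bijective (funext fun v => add_zero _)).mpr hb

lemma isoClass_simpleTwo : isoClass (simpleTwo k).toMod = isoClass (simpleModule k .two) := by
  have h : (simpleTwo k).IsDesc (pullback (simpleHom k .two))
      0 (pullbackElt (simpleHom k .two)).toAddMonoidHom := by
    constructor <;> intros <;>
      simp [smul_pullbackElt, simpleHom_gen, simpleTwo, Algebra.smul_def]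
  refine isoClass_eq_of_isDesc h ?_
  have hb : Function.Bijective fun v : PUnit.{u + 1} × k =>
      pullbackElt (simpleHom k .two) v.2 :=
    (pullbackElt _).bijective.comp (Equiv.punitProd k).bijective
  exact (congrArg Function.Bijective (funext fun v => zero_add _)).mpr hb

/-- The dual number with given `ε`-coefficient and constant term. -/
def dualNumberSwap (k : Type u) [Field k] : k × k ≃+ DualNumber k := AddEquiv.prodComm

lemma algebraMap_mul_dualNumberSwap (c : k) (x : k × k) :
    algebraMap k (DualNumber k) c * dualNumberSwap k x = dualNumberSwap k (c • x) := by
  rw [← Algebra.smul_def]; rfl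

lemma eps_mul_dualNumberSwap (x : k × k) :
    DualNumber.eps * dualNumberSwap k x = dualNumberSwap k (x.2, 0) := by
  have hf : ∀ y, TrivSqZeroExt.fst (dualNumberSwap k y) = y.2 := fun _ => rfl
  have hs : ∀ y, TrivSqZeroExt.snd (dualNumberSwap k y) = y.1 := fun _ => rfl
  refine TrivSqZeroExt.ext ?_ ?_ <;> simp [hf, hs]

lemma isoClass_genSimpleOne :
    isoClass (genSimpleOne k).toMod = isoClass (genSimpleModule k .one) := by
  have h : (genSimpleOne k).IsDesc (pullback (genSimpleHom k .one)) 
      ((pullbackElt (genSimpleHom k .one)).toAddMonoidHom.comp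
        (dualNumberSwap k).toAddMonoidHom) 0 := by
    constructor <;> intros <;>
      simp [smul_pullbackElt, genSimpleHom_gen, genSimpleOne, algebraMap_mul_dualNumberSwap,
        eps_mul_dualNumberSwap]
  refine isoClass_eq_of_isDesc h ?_
  have hb : Function.Bijective fun v : (k × k) × PUnit.{u + 1} =>
      pullbackElt (genSimpleHom k .one) (dualNumberSwap k v.1) :=
    (pullbackElt _).bijective.comp ((dualNumberSwap k).bijective.comp
      (Equiv.prodPUnit (k × k)).bijective)
  exact (congrArg Function.Bijective (funext fun v => add_zero _)).mpr hb

lemma isoClass_genSimpleTwo :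
    isoClass (genSimpleTwo k).toMod = isoClass (genSimpleModule k .two) := by
  have h : (genSimpleTwo k).IsDesc (pullback (genSimpleHom k .two)) 0
      ((pullbackElt (genSimpleHom k .two)).toAddMonoidHom.comp
        (dualNumberSwap k).toAddMonoidHom) := by
    constructor <;> intros <;>
      simp [smul_pullbackElt, genSimpleHom_gen, genSimpleTwo, algebraMap_mul_dualNumberSwap,
        eps_mul_dualNumberSwap]
  refine isoClass_eq_of_isDesc h ?_
  have hb : Function.Bijective fun v : PUnit.{u + 1} × (k × k) =>
      pullbackElt (genSimpleHom k .two) (dualNumberSwap k v.2) :=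
    (pullbackElt _).bijective.comp ((dualNumberSwap k).bijective.comp
      (Equiv.punitProd (k × k)).bijective)
  exact (congrArg Function.Bijective (funext fun v => zero_add _)).mpr hb

end IRep

/-! ### Scalars, sums over the field, and the formal part of the Serre relations. -/

lemma vv_sq (k : Type u) [Field k] : vv k ^ 2 = (Nat.card k : Coeff k) := by
  refine Subtype.ext ?_
  have h : ((vv k : Coeff k) : ℝ) = sqrtQ k := IntermediateField.AdjoinSimple.coe_gen ℚ (sqrtQ k)
  push_cast
  rw [h, sqrtQ, Real.sq_sqrt (Nat.cast_nonneg _)]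

lemma vv_ne_zero (k : Type u) [Field k] [Finite k] : vv k ≠ 0 := by
  intro h
  have := vv_sq k
  rw [h, zero_pow two_ne_zero] at this
  exact Nat.card_pos.ne' (Nat.cast_eq_zero.1 this.symm)

/-- Summation over a finite field of a function which is constant off `0`. -/
lemma sum_eq_of_constant_off_zero {k K A : Type*} [Field k] [Fintype k] [Field K] [AddCommGroup A]
    [Module K A] (F : k → A) (h : ∀ θ, θ ≠ 0 → F θ = F 1) :
    ∑ θ, F θ = F 0 + ((Nat.card k : K) - 1) • F 1 := by
  classical
  rw [← Finset.add_sum_erase _ _ (Finset.mem_univ (0 : k)),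
    Finset.sum_congr rfl fun θ hθ => h θ (Finset.ne_of_mem_erase hθ), Finset.sum_const,
    Finset.card_erase_of_mem (Finset.mem_univ _), Finset.card_univ, Nat.card_eq_fintype_card,
    ← Nat.cast_smul_eq_nsmul K, Nat.cast_sub Fintype.card_pos, Nat.cast_one]

/-- Summation over the square of a finite field of a function which only depends on the vanishing
of the coordinates. -/
lemma sum_prod_eq_of_constant_off_zero {k K A : Type*} [Field k] [Fintype k] [Field K]
    [AddCommGroup A] [Module K A] (F : k × k → A) (h₁ : ∀ a b, a ≠ 0 → F (a, b) = F (1, b))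
    (h₂ : ∀ a b, b ≠ 0 → F (a, b) = F (a, 1)) :
    ∑ θ, F θ = F (0, 0) + ((Nat.card k : K) - 1) • F (1, 0) + ((Nat.card k : K) - 1) • F (0, 1) +
      ((Nat.card k : K) - 1) ^ 2 • F (1, 1) := by
  rw [Fintype.sum_prod_type, sum_eq_of_constant_off_zero (K := K) _ fun a ha => by
      simp only [h₁ a _ ha], sum_eq_of_constant_off_zero (K := K) _ (h₂ 0),
    sum_eq_of_constant_off_zero (K := K) _ (h₂ 1)]
  module

/-- Put Y = T₀₀ + (q-1)T₁₀ + (q-1)T₀₁ + (q-1)²T₁₁. The three terms on the left are v⁻¹(Y - (q-1)T₀₁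
- (q-1)²T₁₁), -(v + v⁻¹)v⁻²Y and v⁻¹(v⁻²Y + (q-1)T₀₁). Their sum is -v⁻¹(q-1)²T₁₁, and T₁₁ = T₁₀ =
s₂e. -/
lemma serre_relation_one {K A : Type*} [Field K] [Ring A] [Algebra K A] {v q : K} (hv : v ≠ 0)
    (hq : v ^ 2 = q) {s₁ s₂ e X U T₀₀ T₁₀ T₀₁ T₁₁ : A} (h21 : s₂ * s₁ = X)
    (hX1 : X * s₁ = v⁻¹ • (T₀₀ + (q - 1) • T₁₀)) (h12 : s₁ * s₂ = v⁻¹ • (X + (q - 1) • U))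
    (h1X : s₁ * X = q⁻¹ • (T₀₀ + (q - 1) • T₁₀ + (q - 1) • T₀₁ + (q - 1) ^ 2 • T₁₁))
    (h1U : s₁ * U = T₀₁) (h2e : s₂ * e = T₁₀) (h : T₁₁ = T₁₀) :
    s₂ * s₁ * s₁ - (v + v⁻¹) • (s₁ * s₂ * s₁) + s₁ * s₁ * s₂ =
      (-((q - 1) ^ 2 / v)) • (s₂ * e) := by
  rw [mul_assoc s₁ s₂, mul_assoc s₁ s₁, h12, mul_smul_comm, mul_add, mul_smul_comm, h21, hX1, h1X,
    h1U, h2e, h]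
  subst hq
  match_scalars <;> field_simp <;> ring

/-- The same cancellation with the factors in the opposite order. Here s₁e = q⁻¹(T₁₀ + (q-1)T₁₁),
which equals T₁₀ once T₁₁ = T₁₀. -/
lemma serre_relation_two {K A : Type*} [Field K] [Ring A] [Algebra K A] {v q : K} (hv : v ≠ 0)
    (hq : v ^ 2 = q) {s₁ s₂ e X U T₀₀ T₁₀ T₀₁ T₁₁ : A} (h21 : s₂ * s₁ = X)
    (h2X : s₂ * X = v⁻¹ • (T₀₀ + (q - 1) • T₁₀)) (h12 : s₁ * s₂ = v⁻¹ • (X + (q - 1) • U))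
    (hX2 : X * s₂ = q⁻¹ • (T₀₀ + (q - 1) • T₁₀ + (q - 1) • T₀₁ + (q - 1) ^ 2 • T₁₁))
    (hU2 : U * s₂ = T₀₁) (h1e : s₁ * e = q⁻¹ • (T₁₀ + (q - 1) • T₁₁)) (h : T₁₁ = T₁₀) :
    s₁ * s₂ * s₂ - (v + v⁻¹) • (s₂ * s₁ * s₂) + s₂ * s₂ * s₁ =
      (-((q - 1) ^ 2 / v)) • (s₁ * e) := by
  rw [mul_assoc s₂ s₂, h12, smul_mul_assoc, add_mul, smul_mul_assoc, h21, hX2, h2X, hU2, h1e, h]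
  subst hq
  match_scalars <;> field_simp <;> ring

/-! ### Counting morphisms between the small representations. -/

namespace IRep

variable {k : Type u} [Field k]

section

variable {V₁ V₂ : Type u} [AddCommGroup V₁] [AddCommGroup V₂] [Module k V₁] [Module k V₂]
variable {W₁ W₂ : Type u} [AddCommGroup W₁] [AddCommGroup W₂] [Module k W₁] [Module k W₂]
variable {M : IRep k V₁ V₂} {N : IRep k W₁ W₂}

lemma card_isHom_eq_one (h : ∀ f₁ f₂, M.IsHom N f₁ f₂ → f₁ = 0 ∧ f₂ = 0) :
    Nat.card {p : (V₁ →ₗ[k] W₁) × (V₂ →ₗ[k] W₂) // M.IsHom N p.1 p.2} = 1 := by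
  refine Nat.card_eq_one_iff_unique.2 ⟨⟨fun p q => Subtype.ext (Prod.ext ?_ ?_)⟩,
    ⟨(0, 0), ⟨fun x => by simp, fun x => by simp, fun x => by simp⟩⟩⟩
  · rw [(h _ _ p.2).1, (h _ _ q.2).1]
  · rw [(h _ _ p.2).2, (h _ _ q.2).2]

lemma card_isHom_eq_card (F : k → (V₁ →ₗ[k] W₁) × (V₂ →ₗ[k] W₂))
    (hF : ∀ t, M.IsHom N (F t).1 (F t).2) (inj : Function.Injective F)
    (surj : ∀ f₁ f₂, M.IsHom N f₁ f₂ → ∃ t, F t = (f₁, f₂)) :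
    Nat.card {p : (V₁ →ₗ[k] W₁) × (V₂ →ₗ[k] W₂) // M.IsHom N p.1 p.2} = Nat.card k := by
  refine (Nat.card_congr (Equiv.ofBijective (fun t => ⟨F t, hF t⟩) ⟨fun s t h => ?_, ?_⟩)).symm
  · exact inj (congrArg Subtype.val h)
  · rintro ⟨⟨f₁, f₂⟩, h⟩
    obtain ⟨t, ht⟩ := surj f₁ f₂ h
    exact ⟨t, Subtype.ext ht⟩

lemma map_punit (f : PUnit.{u + 1} →ₗ[k] V₁) (x : PUnit.{u + 1}) : f x = 0 := by
  rw [Subsingleton.elim x 0, map_zero]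

lemma map_eq_mul (f : k →ₗ[k] k) (x : k) : f x = f 1 * x := by
  rw [mul_comm, ← smul_eq_mul, ← map_smul, smul_eq_mul, mul_one]

/-- The common template of all products below: `c` represents Ext¹, `X` names the middle terms, `d`
is the Euler form and `h` the number of morphisms. -/
lemma cls_mul_cls_eq [Module.Finite k V₁] [Module.Finite k V₂] [Module.Finite k W₁]
    [Module.Finite k W₂] [Finite k] {Θ : Type*} [Fintype Θ] (c : Θ → Cocycle M N) (X : Θ → ModI k)
    {d : ℤ} {h : ℕ} (complete : ∀ c', ∃ θ, (c θ).Cohomologous c')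
    (irredundant : ∀ θ θ', (c θ).Cohomologous (c θ') → θ = θ')
    (hX : ∀ θ, isoClass (c θ).ext.toMod = isoClass (X θ))
    (hd : (Module.finrank k V₁ * Module.finrank k W₁ + Module.finrank k V₂ * Module.finrank k W₂ -
      Module.finrank k V₁ * Module.finrank k W₂ : ℤ) = d)
    (hh : Nat.card {p : (V₁ →ₗ[k] W₁) × (V₂ →ₗ[k] W₂) // M.IsHom N p.1 p.2} = h) :
    cls M.toMod * cls N.toMod = (vv k ^ d / (h : Coeff k)) • ∑ θ, cls (X θ) := by
  rw [cls_mul_cls_of_cocycles c complete irredundant, eulerForm_res, hd, hh]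
  simp only [cls_congr (hX _)]

end

/-! ### Products -/

lemma cls_dim11 {b : k} (hb : b ≠ 0) : cls (dim11 b).toMod = cls (dim11 (1 : k)).toMod :=
  cls_congr (isoClass_dim11 hb)

lemma cls_dim21_left {a : k} (b : k) (ha : a ≠ 0) :
    cls (dim21 a b).toMod = cls (dim21 1 b).toMod := by
  simpa using cls_congr (isoClass_dim21 1 b ha one_ne_zero).symm

lemma cls_dim21_right (a : k) {b : k} (hb : b ≠ 0) :
    cls (dim21 a b).toMod = cls (dim21 a 1).toMod := by
  simpa using cls_congr (isoClass_dim21 a 1 one_ne_zero hb).symm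

lemma cls_dim12_left {a : k} (b : k) (ha : a ≠ 0) :
    cls (dim12 a b).toMod = cls (dim12 1 b).toMod := by
  simpa using cls_congr (isoClass_dim12 1 b ha one_ne_zero)

lemma cls_dim12_right (a : k) {b : k} (hb : b ≠ 0) :
    cls (dim12 a b).toMod = cls (dim12 a 1).toMod := by
  simpa using cls_congr (isoClass_dim12 a 1 one_ne_zero hb)

variable [Finite k]

lemma vv_div_card : vv k ^ (1 : ℤ) / (Nat.card k : Coeff k) = (vv k)⁻¹ := by
  have := vv_ne_zero k
  rw [← vv_sq, zpow_one]
  field_simp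

/-- No arrow runs from 2 to 1, so every component of a cocycle has zero source or target and the
only extension is the split one. -/
lemma cls_simpleTwo_mul_simpleOne :
    cls (simpleTwo k).toMod * cls (simpleOne k).toMod = cls (dim11 (0 : k)).toMod := by
  let c : Unit → Cocycle (simpleTwo k) (simpleOne k) := fun _ =>
    ⟨0, 0, 0, fun x => by simp, fun x => by simp, fun x => by simp⟩
  rw [cls_mul_cls_eq c (fun _ => (dim11 (0 : k)).toMod) (d := 0) (h := 1)
    (fun c' => ⟨(), 0, 0, fun x => by simp [simpleTwo, simpleOne, map_punit, c],
      fun x => by simp [map_punit, simpleTwo, simpleOne, c],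
        fun x => by simp [simpleTwo, simpleOne, c]⟩)
    (fun _ _ _ => rfl)
    (fun _ => isoClass_eq LinearEquiv.prodUnique LinearEquiv.uniqueProd
      ⟨fun x => by simp [dim11, Cocycle.ext_a, simpleTwo, simpleOne, c],
        fun x => by simp [dim11, Cocycle.ext_e₁, simpleOne, c, simpleTwo],
        fun x => by simp [dim11, Cocycle.ext_e₂, simpleTwo, simpleOne, c]⟩)
    (by simp [Module.finrank_zero_of_subsingleton])
    (card_isHom_eq_one fun f₁ f₂ _ => ⟨LinearMap.ext fun x => map_punit _ x,
      LinearMap.ext fun x => rfl⟩)]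
  simp

/-- A cocycle reduces to a scalar loop component at the vertex 1, and coboundaries vanish because
all structure maps do. The Euler form is 1 and Hom is a line, whence the factor v/q = v⁻¹. -/
lemma cls_dim11_zero_mul_simpleOne :
    cls (dim11 (0 : k)).toMod * cls (simpleOne k).toMod = (vv k)⁻¹ •
      (cls (dim21 (0 : k) 0).toMod +
        ((Nat.card k : Coeff k) - 1) • cls (dim21 (1 : k) 0).toMod) := by
  have := Fintype.ofFinite k
  let c : k → Cocycle (dim11 (0 : k)) (simpleOne k) := fun θ =>
    ⟨0, θ • LinearMap.id, 0, fun x => by simp [simpleOne, dim11], fun x => by simp,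
      fun x => by simp⟩
  rw [cls_mul_cls_eq c (fun θ => (dim21 θ 0).toMod) (d := 1) (h := Nat.card k)
    (fun c' => ⟨c'.e₁ 1, 0, 0, fun x => by simp [dim11, simpleOne, c],
      fun x => by simp [c], fun x => by simp⟩)
    (fun θ θ' ⟨h₁, h₂, ha, h1, h2⟩ => by simpa [c, dim11, simpleOne, map_punit] using (h1 1).symm)
    (fun _ => isoClass_eq (LinearEquiv.refl k _) LinearEquiv.uniqueProd
      ⟨fun x => by simp [dim11, dim21, Cocycle.ext_a, simpleOne, c],
        fun x => by simp [dim11, dim21, Cocycle.ext_e₁, simpleOne, c],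
        fun x => by simp [dim11, dim21, Cocycle.ext_e₂, simpleOne, c]⟩)
    (by simp [Module.finrank_zero_of_subsingleton])
    (card_isHom_eq_card (fun t => (t • LinearMap.id, 0))
      (fun t => ⟨fun x => rfl, fun x => by simp [dim11, simpleOne], fun x => rfl⟩)
      (fun s t h => by simpa [dim11, simpleOne, map_punit, c]
        using LinearMap.congr_fun (congrArg Prod.fst h) 1)
      (fun f₁ f₂ _ => ⟨f₁ 1, Prod.ext (LinearMap.ext fun x => (map_eq_mul f₁ x).symm)
        (LinearMap.ext fun x => rfl)⟩)),
    vv_div_card, sum_eq_of_constant_off_zero (K := Coeff k) (fun θ => cls (dim21 θ (0 : k)).toMod)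
      fun θ hθ => cls_dim21_left 0 hθ]

/-- Ext¹(S₁, S₂) is the line of possible arrows; v⁻¹ comes from the Euler form -1. -/
lemma cls_simpleOne_mul_simpleTwo :
    cls (simpleOne k).toMod * cls (simpleTwo k).toMod = (vv k)⁻¹ •
      (cls (dim11 (0 : k)).toMod + ((Nat.card k : Coeff k) - 1) • cls (dim11 (1 : k)).toMod) := by
  have := Fintype.ofFinite k
  let c : k → Cocycle (simpleOne k) (simpleTwo k) := fun θ =>
    ⟨θ • LinearMap.id, 0, 0, fun x => by simp, fun x => by simp,
      fun x => by simp [simpleOne, simpleTwo]⟩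
  rw [cls_mul_cls_eq c (fun θ => (dim11 θ).toMod) (d := -1) (h := 1)
    (fun c' => ⟨c'.a 1, 0, 0, fun x => by simp [c, simpleOne, simpleTwo],
      fun x => by simp [simpleOne, simpleTwo, c],
      fun x => by simp [map_punit]⟩)
    (fun θ θ' ⟨h₁, h₂, ha, h1, h2⟩ => by simpa [c, simpleOne, simpleTwo, map_punit]
      using (ha 1).symm)
    (fun _ => isoClass_eq LinearEquiv.uniqueProd LinearEquiv.prodUnique
      ⟨fun x => by simp [dim11, Cocycle.ext_a, simpleTwo, c, simpleOne],
        fun x => by simp [dim11, Cocycle.ext_e₁, simpleOne, simpleTwo, c],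
        fun x => by simp [dim11, Cocycle.ext_e₂, simpleTwo, c, simpleOne]⟩)
    (by simp [Module.finrank_zero_of_subsingleton])
    (card_isHom_eq_one fun f₁ f₂ _ => ⟨LinearMap.ext fun x => rfl,
      LinearMap.ext fun x => map_punit _ x⟩),
    Nat.cast_one, div_one, zpow_neg_one,
    sum_eq_of_constant_off_zero (K := Coeff k) (fun θ : k => cls (dim11 θ).toMod)
      fun θ hθ => cls_dim11 hθ]

/-- Both the loop at 1 and the arrow are free scalars without coboundaries, so Ext¹ is a plane. The
Euler form is 0 and Hom is a line. -/
lemma cls_simpleOne_mul_dim11_zero :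
    cls (simpleOne k).toMod * cls (dim11 (0 : k)).toMod = (Nat.card k : Coeff k)⁻¹ •
      (cls (dim21 (0 : k) 0).toMod + ((Nat.card k : Coeff k) - 1) • cls (dim21 (1 : k) 0).toMod +
        ((Nat.card k : Coeff k) - 1) • cls (dim21 (0 : k) 1).toMod +
        ((Nat.card k : Coeff k) - 1) ^ 2 • cls (dim21 (1 : k) 1).toMod) := by
  have := Fintype.ofFinite k
  let c : k × k → Cocycle (simpleOne k) (dim11 (0 : k)) := fun θ =>
    ⟨θ.2 • LinearMap.id, θ.1 • LinearMap.id, 0, fun x => by simp [simpleOne, dim11],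
      fun x => by simp [dim11], fun x => by simp [simpleOne, dim11]⟩
  rw [cls_mul_cls_eq c (fun θ => (dim21 θ.1 θ.2).toMod) (d := 0) (h := Nat.card k)
    (fun c' => ⟨(c'.e₁ 1, c'.a 1), 0, 0, fun x => by simp [c, simpleOne, dim11],
      fun x => by simp [c], fun x => by simp [map_punit]⟩)
    (fun θ θ' ⟨h₁, h₂, ha, h1, h2⟩ => Prod.ext
      (by simpa [c, dim11, simpleOne, map_punit] using (h1 1).symm)
      (by simpa [c, dim11, simpleOne, map_punit] using (ha 1).symm))
    (fun _ => isoClass_eq (LinearEquiv.refl k _) LinearEquiv.prodUnique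
      ⟨fun x => by simp [dim11, dim21, Cocycle.ext_a, c, simpleOne],
        fun x => by simp [dim11, dim21, Cocycle.ext_e₁, simpleOne, c],
        fun x => by simp [dim11, dim21, Cocycle.ext_e₂, c, simpleOne]⟩)
    (by simp [Module.finrank_zero_of_subsingleton])
    (card_isHom_eq_card (fun t => (t • LinearMap.id, 0))
      (fun t => ⟨fun x => by simp [dim11], fun x => by simp [dim11, simpleOne],
        fun x => by simp [dim11]⟩)
      (fun s t h => by simpa [simpleOne, dim11, map_punit, c]
        using LinearMap.congr_fun (congrArg Prod.fst h) 1)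
      (fun f₁ f₂ _ => ⟨f₁ 1, Prod.ext (LinearMap.ext fun x => (map_eq_mul f₁ x).symm)
        (LinearMap.ext fun x => (map_punit f₂ x).symm)⟩)),
    zpow_zero, one_div, sum_prod_eq_of_constant_off_zero (K := Coeff k)
      (fun θ : k × k => cls (dim21 θ.1 θ.2).toMod) (fun a b ha => cls_dim21_left b ha)
        (fun a b hb => cls_dim21_right a hb)]

lemma cls_simpleOne_mul_dim11_one :
    cls (simpleOne k).toMod * cls (dim11 (1 : k)).toMod = cls (dim21 (0 : k) 1).toMod := by
  let c : Unit → Cocycle (simpleOne k) (dim11 (1 : k)) := fun _ =>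
    ⟨0, 0, 0, fun x => by simp, fun x => by simp, fun x => by simp⟩
  rw [cls_mul_cls_eq c (fun _ => (dim21 (0 : k) 1).toMod) (d := 0) (h := 1)
    -- The arrow 1 of U makes every arrow component a coboundary, hence the choice h₁ = -a, while
    -- ε₂α = αε₁ forces the loop component to vanish.
    (fun c' => ⟨(), -c'.a, 0, fun x => by simp [dim11, c, simpleOne],
      fun x => by simpa [dim11, simpleOne, c, eq_comm, map_punit] using c'.comm x,
      fun x => by simp [map_punit]⟩)
    (fun _ _ _ => rfl)
    -- In the extension the arrow is nonzero on the first summand, whereas `dim21` uses the second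
    -- projection; hence the swap.
    (fun _ => isoClass_eq (LinearEquiv.prodComm k _ _) LinearEquiv.prodUnique
      ⟨fun x => by simp [dim11, dim21, Cocycle.ext_a, c, simpleOne],
        fun x => by simp [dim11, dim21, Cocycle.ext_e₁, simpleOne, c, Prod.mk_zero_zero],
        fun x => by simp [dim11, dim21, Cocycle.ext_e₂, c, simpleOne]⟩)
    (by simp [Module.finrank_zero_of_subsingleton])
    (card_isHom_eq_one fun f₁ f₂ h => ⟨LinearMap.ext fun x => by
        simpa [dim11, map_punit] using h.arrow x, LinearMap.ext fun x => map_punit _ x⟩)]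
  simp

lemma cls_simpleTwo_mul_genSimpleOne :
    cls (simpleTwo k).toMod * cls (genSimpleOne k).toMod = cls (dim21 (1 : k) 0).toMod := by
  let c : Unit → Cocycle (simpleTwo k) (genSimpleOne k) := fun _ =>
    ⟨0, 0, 0, fun x => by simp, fun x => by simp, fun x => by simp⟩
  rw [cls_mul_cls_eq c (fun _ => (dim21 (1 : k) 0).toMod) (d := 0) (h := 1)
    (fun c' => ⟨(), 0, 0, fun x => by simp [simpleTwo, genSimpleOne, map_punit, c],
      fun x => by simp [map_punit, simpleTwo, genSimpleOne, c],
        fun x => by simp [simpleTwo, genSimpleOne, c]⟩)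
    (fun _ _ _ => rfl)
    (fun _ => isoClass_eq LinearEquiv.prodUnique LinearEquiv.uniqueProd
      ⟨fun x => by simp [dim21, Cocycle.ext_a, simpleTwo, genSimpleOne, c],
        fun x => by simp [dim21, Cocycle.ext_e₁, genSimpleOne, c, simpleTwo],
        fun x => by simp [dim21, Cocycle.ext_e₂, simpleTwo, genSimpleOne, c]⟩)
    (by simp [Module.finrank_zero_of_subsingleton])
    (card_isHom_eq_one fun f₁ f₂ _ => ⟨LinearMap.ext fun x => map_punit _ x,
      LinearMap.ext fun x => rfl⟩)]
  simp

/-- The dual plane of extensions: a loop at the vertex 2 and an arrow, both free. -/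
lemma cls_dim11_zero_mul_simpleTwo :
    cls (dim11 (0 : k)).toMod * cls (simpleTwo k).toMod = (Nat.card k : Coeff k)⁻¹ •
      (cls (dim12 (0 : k) 0).toMod + ((Nat.card k : Coeff k) - 1) • cls (dim12 (1 : k) 0).toMod +
        ((Nat.card k : Coeff k) - 1) • cls (dim12 (0 : k) 1).toMod +
        ((Nat.card k : Coeff k) - 1) ^ 2 • cls (dim12 (1 : k) 1).toMod) := by
  have := Fintype.ofFinite k
  let c : k × k → Cocycle (dim11 (0 : k)) (simpleTwo k) := fun θ =>
    ⟨θ.2 • LinearMap.id, 0, θ.1 • LinearMap.id, fun x => by simp,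
      fun x => by simp [dim11, simpleTwo], fun x => by simp [simpleTwo, dim11]⟩
  rw [cls_mul_cls_eq c (fun θ => (dim12 θ.1 θ.2).toMod) (d := 0) (h := Nat.card k)
    (fun c' => ⟨(c'.e₂ 1, c'.a 1), 0, 0, fun x => by simp [c, dim11, simpleTwo],
      fun x => by simp, fun x => by simp [c]⟩)
    (fun θ θ' ⟨h₁, h₂, ha, h1, h2⟩ => Prod.ext
      (by simpa [c, dim11, simpleTwo, map_punit] using (h2 1).symm)
      (by simpa [c, dim11, simpleTwo, map_punit] using (ha 1).symm))
    (fun _ => isoClass_eq LinearEquiv.uniqueProd (LinearEquiv.refl k _)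
      ⟨fun x => by simp [dim11, dim12, Cocycle.ext_a, simpleTwo, c],
        fun x => by simp [dim11, dim12, Cocycle.ext_e₁, c, simpleTwo],
        fun x => by simp [dim11, dim12, Cocycle.ext_e₂, simpleTwo, c]⟩)
    (by simp [Module.finrank_zero_of_subsingleton])
    (card_isHom_eq_card (fun t => (0, t • LinearMap.id))
      (fun t => ⟨fun x => by simp [dim11, simpleTwo], fun x => rfl,
        fun x => by simp [dim11, simpleTwo]⟩)
      (fun s t h => by simpa [dim11, simpleTwo, map_punit, c]
        using LinearMap.congr_fun (congrArg Prod.snd h) 1)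
      (fun f₁ f₂ _ => ⟨f₂ 1, Prod.ext (LinearMap.ext fun x => rfl)
        (LinearMap.ext fun x => (map_eq_mul f₂ x).symm)⟩)),
    zpow_zero, one_div, sum_prod_eq_of_constant_off_zero (K := Coeff k)
      (fun θ : k × k => cls (dim12 θ.1 θ.2).toMod) (fun a b ha => cls_dim12_left b ha)
        (fun a b hb => cls_dim12_right a hb)]

lemma cls_dim11_one_mul_simpleTwo :
    cls (dim11 (1 : k)).toMod * cls (simpleTwo k).toMod = cls (dim12 (0 : k) 1).toMod := by
  let c : Unit → Cocycle (dim11 (1 : k)) (simpleTwo k) := fun _ =>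
    ⟨0, 0, 0, fun x => by simp, fun x => by simp, fun x => by simp [simpleTwo]⟩
  rw [cls_mul_cls_eq c (fun _ => (dim12 (0 : k) 1).toMod) (d := 0) (h := 1)
    -- Here the arrow of U = `dim11 1` is in the quotient term, so the arrow component is the
    -- coboundary of h₂ = a; commutation again kills the loop component.
    (fun c' => ⟨(), 0, c'.a, fun x => by simp [dim11, c, simpleTwo],
      fun x => by simp [dim11, simpleTwo, c],
      fun x => by simpa [dim11, simpleTwo, c, map_punit] using c'.comm x⟩)
    (fun _ _ _ => rfl)
    (fun _ => isoClass_eq LinearEquiv.uniqueProd (LinearEquiv.prodComm k _ _)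
      ⟨fun x => by simp [dim11, dim12, Cocycle.ext_a, simpleTwo, c],
        fun x => by simp [dim11, dim12, Cocycle.ext_e₁, c, simpleTwo],
        fun x => by simp [dim11, dim12, Cocycle.ext_e₂, simpleTwo, c, Prod.mk_zero_zero]⟩)
    (by simp [Module.finrank_zero_of_subsingleton])
    (card_isHom_eq_one fun f₁ f₂ h => ⟨LinearMap.ext fun x => rfl, LinearMap.ext fun x => by
        simpa [dim11, simpleTwo, eq_comm] using h.arrow x⟩)]
  simp

lemma cls_simpleTwo_mul_dim11_zero :
    cls (simpleTwo k).toMod * cls (dim11 (0 : k)).toMod = (vv k)⁻¹ •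
      (cls (dim12 (0 : k) 0).toMod +
        ((Nat.card k : Coeff k) - 1) • cls (dim12 (1 : k) 0).toMod) := by
  have := Fintype.ofFinite k
  let c : k → Cocycle (simpleTwo k) (dim11 (0 : k)) := fun θ =>
    ⟨0, 0, θ • LinearMap.id, fun x => by simp, fun x => by simp [simpleTwo, dim11],
      fun x => by simp [map_punit]⟩
  rw [cls_mul_cls_eq c (fun θ => (dim12 θ 0).toMod) (d := 1) (h := Nat.card k)
    (fun c' => ⟨c'.e₂ 1, 0, 0, fun x => by simp [map_punit, simpleTwo, dim11, c],
      fun x => by simp [map_punit, simpleTwo, dim11, c],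
      fun x => by simp [c]⟩)
    (fun θ θ' ⟨h₁, h₂, ha, h1, h2⟩ => by simpa [c, dim11, simpleTwo, map_punit] using (h2 1).symm)
    (fun _ => isoClass_eq LinearEquiv.prodUnique (LinearEquiv.refl k _)
      ⟨fun x => by simp [dim11, dim12, Cocycle.ext_a, simpleTwo, c, Prod.mk_zero_zero],
        fun x => by simp [dim11, dim12, Cocycle.ext_e₁, c, simpleTwo],
        fun x => by simp [dim11, dim12, Cocycle.ext_e₂, simpleTwo, c]⟩)
    (by simp [Module.finrank_zero_of_subsingleton])
    (card_isHom_eq_card (fun t => (0, t • LinearMap.id))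
      (fun t => ⟨fun x => by simp [map_punit], fun x => by simp,
        fun x => by simp [dim11, simpleTwo]⟩)
      (fun s t h => by simpa [simpleTwo, dim11, map_punit, c]
        using LinearMap.congr_fun (congrArg Prod.snd h) 1)
      (fun f₁ f₂ _ => ⟨f₂ 1, Prod.ext (LinearMap.ext fun x => (map_punit f₁ x).symm)
        (LinearMap.ext fun x => (map_eq_mul f₂ x).symm)⟩)),
    vv_div_card, sum_eq_of_constant_off_zero (K := Coeff k) (fun θ => cls (dim12 θ (0 : k)).toMod)
      fun θ hθ => cls_dim12_left 0 hθ]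

lemma cls_simpleOne_mul_genSimpleTwo :
    cls (simpleOne k).toMod * cls (genSimpleTwo k).toMod = (Nat.card k : Coeff k)⁻¹ •
      (cls (dim12 (1 : k) 0).toMod +
        ((Nat.card k : Coeff k) - 1) • cls (dim12 (1 : k) 1).toMod) := by
  have := Fintype.ofFinite k
  let c : k → Cocycle (simpleOne k) (genSimpleTwo k) := fun θ =>
    ⟨θ • LinearMap.inl k k k, 0, 0, fun x => by simp, fun x => by simp,
      fun x => by simp [simpleOne, genSimpleTwo]⟩
  -- The Euler form is -2, because 𝔼₂ has dimension two at the vertex 2.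
  have hv : vv k ^ (-2 : ℤ) / ((1 : ℕ) : Coeff k) = (Nat.card k : Coeff k)⁻¹ := by
    rw [Nat.cast_one, div_one, zpow_neg, ← vv_sq]; rfl
  rw [cls_mul_cls_eq c (fun θ => (dim12 1 θ).toMod) (d := -2) (h := 1)
    (fun c' => ⟨(c'.a 1).1, 0, 0, fun x => by
        -- Since the loop of S₁ is zero, the relation ε₂α = αε₁ confines the arrow to the kernel of
        -- the Jordan block; Ext¹(S₁, 𝔼₂) is therefore a line.
        have h : (c'.a x).2 = 0 := by simpa [simpleOne, genSimpleTwo, map_punit] using c'.comm x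
        exact Prod.ext
          (by simpa [c, simpleOne, genSimpleTwo, map_punit]
            using map_eq_mul (LinearMap.fst k k k ∘ₗ c'.a) x)
          (by simp [c, h, simpleOne, genSimpleTwo]),
      fun x => by simp, fun x => by simp [map_punit]⟩)
    (fun θ θ' ⟨h₁, h₂, ha, h1, h2⟩ => by
      simpa [c, simpleOne, genSimpleTwo, map_punit] using (congrArg Prod.fst (ha 1)).symm)
    (fun _ => isoClass_eq LinearEquiv.uniqueProd LinearEquiv.prodUnique
      ⟨fun x => by simp [dim12, Cocycle.ext_a, genSimpleTwo, c, simpleOne],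
        fun x => by simp [dim12, Cocycle.ext_e₁, simpleOne, genSimpleTwo, c],
        fun x => by simp [dim12, Cocycle.ext_e₂, genSimpleTwo, c, simpleOne]⟩)
    (by simp [Module.finrank_zero_of_subsingleton])
    (card_isHom_eq_one fun f₁ f₂ _ => ⟨LinearMap.ext fun x => rfl,
      LinearMap.ext fun x => map_punit _ x⟩),
    hv, sum_eq_of_constant_off_zero (K := Coeff k) (fun θ : k => cls (dim12 1 θ).toMod)
      fun θ hθ => cls_dim12_right 1 hθ]

end IRep

end IHall

end

/-! ### The ıSerre relations. -/

open IHall IRep in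
theorem mainTheorem11 (k : Type u) [Field k] [Finite k] :
    IHall.cls (IHall.simpleModule k .two) * IHall.cls (IHall.simpleModule k .one) *
          IHall.cls (IHall.simpleModule k .one)
        - (IHall.vv k + (IHall.vv k)⁻¹) •
          (IHall.cls (IHall.simpleModule k .one) * IHall.cls (IHall.simpleModule k .two) *
            IHall.cls (IHall.simpleModule k .one))
        + IHall.cls (IHall.simpleModule k .one) * IHall.cls (IHall.simpleModule k .one) *
          IHall.cls (IHall.simpleModule k .two)
      = (-(((Nat.card k : IHall.Coeff k) - 1) ^ 2 / IHall.vv k)) •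
          (IHall.cls (IHall.simpleModule k .two) * IHall.cls (IHall.genSimpleModule k .one)) ∧
    IHall.cls (IHall.simpleModule k .one) * IHall.cls (IHall.simpleModule k .two) *
          IHall.cls (IHall.simpleModule k .two)
        - (IHall.vv k + (IHall.vv k)⁻¹) •
          (IHall.cls (IHall.simpleModule k .two) * IHall.cls (IHall.simpleModule k .one) *
            IHall.cls (IHall.simpleModule k .two))
        + IHall.cls (IHall.simpleModule k .two) * IHall.cls (IHall.simpleModule k .two) *
          IHall.cls (IHall.simpleModule k .one)
      = (-(((Nat.card k : IHall.Coeff k) - 1) ^ 2 / IHall.vv k)) •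
          (IHall.cls (IHall.simpleModule k .one) * IHall.cls (IHall.genSimpleModule k .two)) := by
  rw [← cls_congr (isoClass_simpleOne (k := k)), ← cls_congr (isoClass_simpleTwo (k := k)),
    ← cls_congr (isoClass_genSimpleOne (k := k)), ← cls_congr (isoClass_genSimpleTwo (k := k))]
  -- X and U are the classes of `dim11 0` and `dim11 1`; T_ab is the class of `dim21 a b` in the
  -- first relation and of `dim12 a b` in the second.
  exact ⟨serre_relation_one (K := Coeff k) (A := IHallAlgebra k) (vv_ne_zero k) (vv_sq k)
    cls_simpleTwo_mul_simpleOne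
      cls_dim11_zero_mul_simpleOne cls_simpleOne_mul_simpleTwo cls_simpleOne_mul_dim11_zero
      cls_simpleOne_mul_dim11_one cls_simpleTwo_mul_genSimpleOne (cls_dim21_one 1),
    serre_relation_two (K := Coeff k) (A := IHallAlgebra k) (vv_ne_zero k) (vv_sq k)
      cls_simpleTwo_mul_simpleOne
      cls_simpleTwo_mul_dim11_zero cls_simpleOne_mul_simpleTwo cls_dim11_zero_mul_simpleTwo
      cls_dim11_one_mul_simpleTwo cls_simpleOne_mul_genSimpleTwo (cls_dim12_one 1)⟩
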